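/- Consider the word RAM with unit-cost instructions (assignment of constants, addition, truncated subtraction, multiplication, integer division and remainder, indirect load and store, jumps and comparisons, reading the next symbol of a one-way input tape, writing a word to an output tape). There are a single program and a constant $c$ such that the following holds for every $\sigma$ and every non-empty text $T$ of length $n$ over the alphabet $\{0,\dots,\sigma-1\}$. With words of $c\log_2(n+\sigma)$ bits (that is, all values occurring are smaller than $(n+\sigma)^c$), there is a data structure for $T$ that occupies at most $cn$ words and from which the program, using at most $cn$ further words of scratch memory with arbitrary initial contents, answers every query of the following kind: given on the input tape a pattern $P$ of length $m$ over the same alphabet, it outputs the list of all start positions of occurrences of $P$ in $T$, each exactly once and in increasing order (text order), after at most $c\,(m+occ)$ steps, where $occ$ is the number of occurrences of $P$ in $T$; after the query the data structure is unchanged. In short: all occurrences of a pattern can be reported, sorted in text order, in $O(m+occ)$ time using $O(n)$ space. (Positions are counted from $0$; the empty pattern occurs at the $n+1$ positions $0,\dots,n$.) -/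

import Mathlib

/-! A word RAM: finitely many registers are addressable by the (finite) program, the memory is a
finite array of words with indirect addressing, the input is a read-only one-way tape and the
output a write-only tape.  Every word is a natural number below the bound `B`, that is, it
consists of `log₂ B` bits; each instruction takes one unit of time. -/

namespace WordRAM

/-- Binary word operations; subtraction is truncated at `0`, division rounds down. -/
inductive BinOp where
  | add | sub | mul | div | mod

def BinOp.eval : BinOp → ℕ → ℕ → ℕ
  | .add, x, y => x + y
  | .sub, x, y => x - y
  | .mul, x, y => x * y
  | .div, x, y => x / y
  | .mod, x, y => x % y

/-- Instructions.  `r`, `s`, `t` are register numbers, `l` is a program line. -/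
inductive Instr where
  /-- `r := k` -/
  | const (r k : ℕ)
  /-- `r := s o t` -/
  | op (o : BinOp) (r s t : ℕ)
  /-- `r := memory[s]` -/
  | load (r s : ℕ)
  /-- `memory[s] := r` -/
  | store (s r : ℕ)
  /-- go to line `l` -/
  | jump (l : ℕ)
  /-- if `s < t`, go to line `l` -/
  | jlt (s t l : ℕ)
  /-- move the next input symbol to `r`; if the input is exhausted, go to line `l` -/
  | read (r l : ℕ)
  /-- append the contents of `s` to the output -/
  | write (s : ℕ)
  | halt

structure Config where
  pc : ℕ
  reg : ℕ → ℕ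
  mem : List ℕ
  input : List ℕ
  output : List ℕ

/-- Initially all registers are `0`. -/
def init (mem input : List ℕ) : Config := ⟨0, fun _ => 0, mem, input, []⟩

/-- Put `v` into register `r` and go to the next line; a fault if `v` does not fit in a word. -/
def Config.put (B : ℕ) (c : Config) (r v : ℕ) : Option Config :=
  if v < B then some { c with pc := c.pc + 1, reg := Function.update c.reg r v } else none

/-- One step.  There is no next configuration if the machine has halted, or at a fault: a program
line or a memory cell that does not exist, or a value that does not fit in a word. -/
def step (B : ℕ) (prog : List Instr) (c : Config) : Option Config :=
  match prog[c.pc]? with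
  | none => none
  | some .halt => none
  | some (.const r k) => c.put B r k
  | some (.op o r s t) => c.put B r (o.eval (c.reg s) (c.reg t))
  | some (.load r s) =>
      match c.mem[c.reg s]? with
      | none => none
      | some v => c.put B r v
  | some (.store s r) =>
      if c.reg s < c.mem.length then
        some { c with pc := c.pc + 1, mem := c.mem.set (c.reg s) (c.reg r) }
      else none
  | some (.jump l) => some { c with pc := l }
  | some (.jlt s t l) => some { c with pc := if c.reg s < c.reg t then l else c.pc + 1 }
  | some (.read r l) =>
      match c.input with
      | [] => some { c with pc := l }
      | a :: rest => Config.put B { c with input := rest } r a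
  | some (.write s) => some { c with pc := c.pc + 1, output := c.output ++ [c.reg s] }

/-- The configuration after exactly `t` steps, if there is one. -/
def run (B : ℕ) (prog : List Instr) : ℕ → Config → Option Config
  | 0, c => some c
  | t + 1, c => (step B prog c).bind (run B prog t)

/-- Started with the memory `mem` and the input `input`, the program reaches the instruction
`halt` after exactly `t` steps without a fault; then the memory is `mem'` and the output is
`output`. -/
def HaltsIn (B : ℕ) (prog : List Instr) (mem input : List ℕ) (t : ℕ)
    (mem' output : List ℕ) : Prop :=
  ∃ c : Config, run B prog t (init mem input) = some c ∧ prog[c.pc]? = some Instr.halt ∧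
    c.mem = mem' ∧ c.output = output

end WordRAM

/-- The start positions (counted from `0`) of the occurrences of the pattern `P` in the text `T`:
those `i ≤ |T|` for which `P` is an initial segment of the suffix of `T` that starts at `i`. -/
def occurrences {σ : ℕ} (P T : List (Fin σ)) : Finset ℕ :=
  (Finset.range (T.length + 1)).filter fun i => P <+: T.drop i

/-!
Occurrences are found in a suffix tree and put into text order by a radix sort whose keys are
precomputed; both parts take time linear in the pattern and in the number of occurrences.

*The tree.*  The nonempty sets of occurrences of words in `T` form a laminar family on the
`n + 1` positions, so there are `O(n)` of them (`IsLaminar.card_le`); they are the nodes of the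
suffix tree.  A node stores the length of its longest word and one occurrence of it, which spells
the edge that leads to it.  A child is looked up by its first letter in a two-level perfect hash
table (`exists_perfectHash`), which takes linear space and constant time for every alphabet.  In
the order of the suffix array a node is an interval (`exists_suffixArray`), so its elements can be
listed in constant time each, but not in text order.

*The order.*  Level `j` has the radix `K = 2 ^ 2 ^ j` and serves the nodes with at most `K ^ 2`
elements.  Each position carries, for this level, its rank inside the largest such node that
contains it.  Inside one node of the level these ranks increase with the positions
(`IsLaminar.exists_rank`), and they have two digits to the base `K`.  For a node with `k` elements
the least level that serves it has `K ≤ 2 * k` (`exists_level`), so a radix sort with two passes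
over `K` buckets sorts the node in `O(k)` steps.  A key of level `j` takes `2 ^ (j + 1)` bits;
packed into words of `O(log n)` bits, the keys of all levels together form a geometric sum of
`O(n)` words (`exists_levels`).

*The machine.*  The data structure consists of twenty interleaved arrays.  The program is verified
block by block with weakest preconditions (`WordRAM.wp`, `Reaches.block`), in continuation-passing
style: `Reaches B prog Q t c` says that from `c` a configuration satisfying `Q` is reached within
`t` steps, and each lemma about a part of the program adds its own running time to that of the
rest.  `reaches_match` treats the loop over the pattern and `reaches_report` the sorting, where the
buckets are linked lists in the scratch memory (`Chain`).
-/

open WordRAM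

/-! ### Laminar families -/

/-- Two members of the family are nested or disjoint. -/
def IsLaminar (𝓕 : Finset (Finset ℕ)) : Prop :=
  ∀ S ∈ 𝓕, ∀ R ∈ 𝓕, S ⊆ R ∨ R ⊆ S ∨ Disjoint S R

/-- A member is determined by its least element outside the largest proper submember that contains
its minimum; only singletons lack such an element. -/
theorem IsLaminar.card_le {𝓕 : Finset (Finset ℕ)} (h𝓕 : IsLaminar 𝓕) {N : ℕ}
    (hne : ∀ S ∈ 𝓕, S.Nonempty) (hN : ∀ S ∈ 𝓕, S ⊆ Finset.range N) : 𝓕.card ≤ 2 * N := by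
  classical
  -- a member with two or more elements is sent to its least element outside `U S`
  let U : Finset ℕ → Finset ℕ := fun S =>
    S.filter fun x => ∃ m ∈ S, (∀ y ∈ S, m ≤ y) ∧ (x = m ∨ ∃ R ∈ 𝓕, R ⊂ S ∧ m ∈ R ∧ x ∈ R)
  have hU : ∀ S ∈ 𝓕, S.card ≠ 1 → (S \ U S).Nonempty := by
    intro S hS h1
    by_contra hcon
    rw [Finset.not_nonempty_iff_eq_empty, Finset.sdiff_eq_empty_iff_subset] at hcon
    set m := S.min' (hne S hS) with hm
    have hmS : m ∈ S := Finset.min'_mem _ _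
    have huniq : ∀ m' ∈ S, (∀ y ∈ S, m' ≤ y) → m' = m := fun m' hm' h =>
      le_antisymm (h m hmS) (Finset.min'_le _ _ hm')
    have hcov : ∀ x ∈ S, x = m ∨ ∃ R ∈ 𝓕, R ⊂ S ∧ m ∈ R ∧ x ∈ R := by
      intro x hx
      obtain ⟨m', hm', h', h⟩ := (Finset.mem_filter.1 (hcon hx)).2
      obtain rfl := huniq m' hm' h'
      exact h
    -- the proper members that contain `m` form a chain; a largest one is all of `S`
    have h2 : ∃ x ∈ S, x ≠ m := by
      by_contra hall
      push Not at hall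
      exact h1 (Finset.card_eq_one.2 ⟨m, Finset.eq_singleton_iff_unique_mem.2 ⟨hmS, hall⟩⟩)
    obtain ⟨x, hx, hxm⟩ := h2
    obtain ⟨R₀, hR₀, hR₀S, hmR₀, -⟩ := (hcov x hx).resolve_left hxm
    obtain ⟨R, hR, hmax⟩ := Finset.exists_max_image
      (𝓕.filter fun R => R ⊂ S ∧ m ∈ R) Finset.card ⟨R₀, by simp [hR₀, hR₀S, hmR₀]⟩
    simp only [Finset.mem_filter] at hR hmax
    obtain ⟨hR𝓕, hRS, hmR⟩ := hR
    obtain ⟨y, hyS, hyR⟩ := Finset.exists_of_ssubset hRS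
    obtain ⟨R', hR', hR'S, hmR', hyR'⟩ :=
      (hcov y hyS).resolve_left (fun h => hyR (h ▸ hmR))
    rcases h𝓕 R hR𝓕 R' hR' with h | h | h
    · have := Finset.card_lt_card
        (Finset.ssubset_iff_subset_ne.2 ⟨h, fun e => hyR (e ▸ hyR')⟩)
      exact absurd (hmax R' ⟨hR', hR'S, hmR'⟩) (by omega)
    · exact hyR (h hyR')
    · exact Finset.disjoint_left.1 h hmR hmR'
  let g : Finset ℕ → ℕ := fun S => if h : (S \ U S).Nonempty then (S \ U S).min' h else 0
  have hg : ∀ S ∈ 𝓕, S.card ≠ 1 → g S ∈ S \ U S ∧ ∀ y ∈ S \ U S, g S ≤ y := by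
    intro S hS h1
    simp only [g, dif_pos (hU S hS h1)]
    exact ⟨Finset.min'_mem _ _, fun y hy => Finset.min'_le _ _ hy⟩
  have key : ∀ S ∈ 𝓕, S.card ≠ 1 → ∀ R ∈ 𝓕, R.card ≠ 1 → g S = g R → R ⊂ S → False := by
    intro S hS hS1 R hR hR1 hgg hRS
    obtain ⟨hgS, hgS'⟩ := hg S hS hS1
    obtain ⟨hgR, -⟩ := hg R hR hR1
    rw [← hgg] at hgR
    simp only [Finset.mem_sdiff] at hgS hgR
    have minS := Finset.min'_mem S (hne S hS)
    have minR := Finset.min'_mem R (hne R hR)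
    set m := S.min' (hne S hS)
    set r := R.min' (hne R hR)
    have hrx : r < g S := by
      refine lt_of_le_of_ne (Finset.min'_le _ _ hgR.1) fun h => hgR.2 ?_
      exact Finset.mem_filter.2 ⟨hgR.1, r, minR, fun y hy => Finset.min'_le _ _ hy, Or.inl h.symm⟩
    have hin : ∀ R' ∈ 𝓕, R' ⊂ S → m ∈ R' → g S ∉ R' := fun R' hR' h1 h2 h3 =>
      hgS.2 (Finset.mem_filter.2 ⟨hgS.1, m, minS, fun y hy => Finset.min'_le _ _ hy,
        Or.inr ⟨R', hR', h1, h2, h3⟩⟩)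
    have hrU : r ∈ U S := by
      by_contra h
      have := hgS' r (Finset.mem_sdiff.2 ⟨hRS.1 minR, h⟩)
      omega
    obtain ⟨m', hm', hle, h⟩ := (Finset.mem_filter.1 hrU).2
    obtain rfl : m' = m := le_antisymm (hle m minS) (Finset.min'_le _ _ hm')
    rcases h with h | ⟨R', hR', hR'S, hmR', hrR'⟩
    · exact hin R hR hRS (h ▸ minR) hgR.1
    · rcases h𝓕 R hR R' hR' with h | h | h
      · exact hin R' hR' hR'S hmR' (h hgR.1)
      · exact hin R hR hRS (h hmR') hgR.1
      · exact Finset.disjoint_left.1 h minR hrR'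
  have h1 : (𝓕.filter fun S => S.card = 1).card ≤ N := by
    calc _ ≤ ((Finset.range N).image fun x => ({x} : Finset ℕ)).card := by
          refine Finset.card_le_card fun S hS => ?_
          obtain ⟨hS, h1⟩ := Finset.mem_filter.1 hS
          obtain ⟨x, rfl⟩ := Finset.card_eq_one.1 h1
          exact Finset.mem_image.2 ⟨x, hN _ hS (Finset.mem_singleton_self x), rfl⟩
      _ ≤ N := by simpa using Finset.card_image_le (s := Finset.range N) (f := fun x => ({x} : Finset ℕ))
  have h2 : (𝓕.filter fun S => ¬ S.card = 1).card ≤ N := by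
    rw [← Finset.card_range N]
    refine Finset.card_le_card_of_injOn g ?_ ?_
    · intro S hS
      obtain ⟨hS, h1⟩ := Finset.mem_filter.1 hS
      exact hN S hS (Finset.mem_sdiff.1 (hg S hS h1).1).1
    · intro S hS R hR hgg
      obtain ⟨hS, hS1⟩ := Finset.mem_filter.1 hS
      obtain ⟨hR, hR1⟩ := Finset.mem_filter.1 hR
      by_contra hne'
      rcases h𝓕 S hS R hR with h | h | h
      · exact key R hR hR1 S hS hS1 hgg.symm (Finset.ssubset_iff_subset_ne.2 ⟨h, hne'⟩)
      · exact key S hS hS1 R hR hR1 hgg (Finset.ssubset_iff_subset_ne.2 ⟨h, Ne.symm hne'⟩)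
      · have a := (Finset.mem_sdiff.1 (hg S hS hS1).1).1
        have b := (Finset.mem_sdiff.1 (hg R hR hR1).1).1
        rw [← hgg] at b
        exact Finset.disjoint_left.1 h a b
  have := Finset.card_filter_add_card_filter_not (s := 𝓕) (fun S => S.card = 1)
  omega

/-- Rank keys.  An element is ranked inside the largest member of size at most `N` that contains
it; two elements of a member of size at most `N` are ranked inside the same set. -/
theorem IsLaminar.exists_rank {𝓕 : Finset (Finset ℕ)} (h𝓕 : IsLaminar 𝓕) {N : ℕ} (hN : 0 < N) :
    ∃ key : ℕ → ℕ, (∀ x, key x < N) ∧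
      ∀ S ∈ 𝓕, S.card ≤ N → ∀ x ∈ S, ∀ y ∈ S, x < y → key x < key y := by
  classical
  have hex : ∀ x, ∃ U : Finset ℕ, U.card ≤ N ∧ (U = ∅ ∨ U ∈ 𝓕 ∧ x ∈ U) ∧
      ∀ S ∈ 𝓕, S.card ≤ N → x ∈ S → S.card ≤ U.card ∧ (U ∈ 𝓕 ∧ x ∈ U) := by
    intro x
    by_cases h : (𝓕.filter fun S => S.card ≤ N ∧ x ∈ S).Nonempty
    · obtain ⟨U, hU, hmax⟩ := Finset.exists_max_image _ Finset.card h
      simp only [Finset.mem_filter] at hU hmax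
      exact ⟨U, hU.2.1, Or.inr ⟨hU.1, hU.2.2⟩,
        fun S hS h1 h2 => ⟨hmax S ⟨hS, h1, h2⟩, hU.1, hU.2.2⟩⟩
    · refine ⟨∅, by simp, Or.inl rfl, fun S hS h1 h2 => absurd ?_ h⟩
      exact ⟨S, by simp [hS, h1, h2]⟩
  choose U hU1 hU2 hU3 using hex
  have hsub : ∀ S ∈ 𝓕, S.card ≤ N → ∀ x ∈ S, S ⊆ U x := by
    intro S hS hSN x hx
    obtain ⟨h1, h2, h3⟩ := hU3 x S hS hSN hx
    rcases h𝓕 S hS _ h2 with h | h | h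
    · exact h
    · rw [Finset.eq_of_subset_of_card_le h h1]
    · exact absurd h3 (Finset.disjoint_left.1 h hx)
  refine ⟨fun x => ((U x).filter (· < x)).card, fun x => ?_, ?_⟩
  · rcases hU2 x with h | ⟨-, h⟩
    · simpa [h] using hN
    · refine lt_of_lt_of_le (Finset.card_lt_card ?_) (hU1 x)
      exact Finset.filter_ssubset.2 ⟨x, h, lt_irrefl x⟩
  · intro S hS hSN x hx y hy hxy
    have hyx : y ∈ U x := hsub S hS hSN x hx hy
    have hxy' : x ∈ U y := hsub S hS hSN y hy hx
    have hUx := (hU3 x S hS hSN hx).2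
    have hUy := (hU3 y S hS hSN hy).2
    have e : U x = U y := Finset.Subset.antisymm
      (hsub _ hUx.1 (hU1 x) y hyx) (hsub _ hUy.1 (hU1 y) x hxy')
    simp only [e]
    refine Finset.card_lt_card (Finset.ssubset_iff_of_subset ?_ |>.2 ⟨x, ?_, ?_⟩)
    · intro z hz
      simp only [Finset.mem_filter] at hz ⊢
      exact ⟨hz.1, hz.2.trans hxy⟩
    · simp [hxy', hxy]
    · simp

/-! ### Occurrence sets -/

section Occurrences

variable {σ : ℕ} {T : List (Fin σ)}

theorem mem_occurrences {P : List (Fin σ)} {i : ℕ} :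
    i ∈ occurrences P T ↔ i ≤ T.length ∧ P <+: T.drop i := by
  simp [occurrences]

theorem occurrences_anti {P Q : List (Fin σ)} (h : P <+: Q) :
    occurrences Q T ⊆ occurrences P T := fun i hi => by
  rw [mem_occurrences] at hi ⊢
  exact ⟨hi.1, h.trans hi.2⟩

theorem occurrences_nil : occurrences [] T = Finset.range (T.length + 1) := by
  ext i; simp [mem_occurrences]

theorem occurrences_subset_range (P : List (Fin σ)) :
    occurrences P T ⊆ Finset.range (T.length + 1) := Finset.filter_subset _ _

theorem length_add_le_of_mem_occurrences {P : List (Fin σ)} {i : ℕ} (h : i ∈ occurrences P T) :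
    i + P.length ≤ T.length := by
  obtain ⟨h1, h2⟩ := mem_occurrences.1 h
  have := h2.length_le
  rw [List.length_drop] at this
  omega

theorem mem_occurrences_snoc {P : List (Fin σ)} {a : Fin σ} {i : ℕ} :
    i ∈ occurrences (P ++ [a]) T ↔ i ∈ occurrences P T ∧ T[i + P.length]? = some a := by
  rw [mem_occurrences, mem_occurrences, and_assoc, and_congr_right_iff]
  intro _
  constructor
  · rintro ⟨t, ht⟩
    refine ⟨⟨a :: t, by simpa using ht⟩, ?_⟩
    rw [← List.getElem?_drop, ← ht]
    simp
  · rintro ⟨⟨t, ht⟩, h⟩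
    rw [← List.getElem?_drop, ← ht] at h
    rw [← ht]
    cases t with
    | nil => simp at h
    | cons b t =>
      simp at h
      exact ⟨t, by simp [h]⟩

/-- The nodes of the suffix tree of `T`, encoded as the nonempty occurrence sets. -/
noncomputable def nodes (T : List (Fin σ)) : Finset (Finset ℕ) :=
  open Classical in (Finset.range (T.length + 1)).powerset.filter fun S =>
    S.Nonempty ∧ ∃ w, occurrences w T = S

theorem mem_nodes {S : Finset ℕ} : S ∈ nodes T ↔ S.Nonempty ∧ ∃ w, occurrences w T = S := by
  classical
  simp only [nodes, Finset.mem_filter, Finset.mem_powerset, and_iff_right_iff_imp]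
  rintro ⟨-, w, rfl⟩
  exact occurrences_subset_range w

theorem subset_range_of_mem_nodes {S : Finset ℕ} (h : S ∈ nodes T) :
    S ⊆ Finset.range (T.length + 1) := by
  obtain ⟨-, w, rfl⟩ := mem_nodes.1 h
  exact occurrences_subset_range w

theorem range_mem_nodes : Finset.range (T.length + 1) ∈ nodes T :=
  mem_nodes.2 ⟨⟨0, by simp⟩, [], occurrences_nil⟩

theorem isLaminar_nodes : IsLaminar (nodes T) := by
  intro S hS R hR
  obtain ⟨-, v, rfl⟩ := mem_nodes.1 hS
  obtain ⟨-, w, rfl⟩ := mem_nodes.1 hR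
  by_cases h : Disjoint (occurrences v T) (occurrences w T)
  · exact Or.inr (Or.inr h)
  · obtain ⟨i, hv, hw⟩ := Finset.not_disjoint_iff.1 h
    rcases List.prefix_or_prefix_of_prefix (mem_occurrences.1 hv).2 (mem_occurrences.1 hw).2
      with h | h
    · exact Or.inr (Or.inl (occurrences_anti h))
    · exact Or.inl (occurrences_anti h)

theorem card_nodes_le : (nodes T).card ≤ 2 * (T.length + 1) :=
  isLaminar_nodes.card_le (fun _ h => (mem_nodes.1 h).1) fun _ h => subset_range_of_mem_nodes h

/-- The words with a given nonempty occurrence set are prefixes of one suffix of the text, so there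
is a longest one. -/
theorem exists_label {S : Finset ℕ} (hS : S ∈ nodes T) :
    ∃ w, occurrences w T = S ∧ ∀ v, occurrences v T = S → v <+: w := by
  obtain ⟨⟨i, hi⟩, w₀, hw₀⟩ := mem_nodes.1 hS
  have hb : ∀ v, occurrences v T = S → v.length ≤ T.length := fun v hv => by
    have := length_add_le_of_mem_occurrences (hv ▸ hi)
    omega
  classical
  let p : ℕ → Prop := fun d => ∃ v, occurrences v T = S ∧ v.length = d
  have hp : p (Nat.findGreatest p T.length) :=
    Nat.findGreatest_spec (hb w₀ hw₀) ⟨w₀, hw₀, rfl⟩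
  obtain ⟨w, hw, hwl⟩ := hp
  refine ⟨w, hw, fun v hv => ?_⟩
  have hle : v.length ≤ w.length := by
    rw [hwl]
    exact Nat.le_findGreatest (hb v hv) ⟨v, hv, rfl⟩
  exact List.prefix_of_prefix_length_le (mem_occurrences.1 (hv ▸ hi)).2
    (mem_occurrences.1 (hw ▸ hi)).2 hle

/-- The longest word with occurrence set `S`: the string spelled on the path from the root to the
node `S`. -/
noncomputable def label (T : List (Fin σ)) (S : Finset ℕ) : List (Fin σ) :=
  open Classical in
  if h : ∃ w, occurrences w T = S ∧ ∀ v, occurrences v T = S → v <+: w then h.choose else []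

theorem occurrences_label {S : Finset ℕ} (hS : S ∈ nodes T) : occurrences (label T S) T = S := by
  rw [label, dif_pos (exists_label hS)]
  exact (exists_label hS).choose_spec.1

theorem prefix_label {S : Finset ℕ} (hS : S ∈ nodes T) {w : List (Fin σ)}
    (hw : occurrences w T = S) : w <+: label T S := by
  rw [label, dif_pos (exists_label hS)]
  exact (exists_label hS).choose_spec.2 w hw

/-- Inside an edge, the only letter that can follow is read off any occurrence. -/
theorem occurrences_snoc_of_lt {S : Finset ℕ} (hS : S ∈ nodes T) {w : List (Fin σ)}
    (hw : occurrences w T = S) (hlt : w.length < (label T S).length) {i : ℕ} (hi : i ∈ S)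
    (a : Fin σ) :
    occurrences (w ++ [a]) T = if T[i + w.length]? = some a then S else ∅ := by
  have hpre := prefix_label hS hw
  have hall : ∀ x ∈ S, T[x + w.length]? = (label T S)[w.length]? := by
    intro x hx
    have h2 := (mem_occurrences.1 ((occurrences_label hS).symm ▸ hx)).2
    obtain ⟨t, ht⟩ := h2
    rw [← List.getElem?_drop, ← ht, List.getElem?_append_left hlt]
  ext x
  rw [mem_occurrences_snoc, hw]
  split_ifs with h
  · exact ⟨And.left, fun hx => ⟨hx, by rw [hall x hx, ← hall i hi, h]⟩⟩
  · simp only [Finset.notMem_empty, iff_false, not_and]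
    intro hx h'
    exact h (by rw [hall i hi, ← hall x hx, h'])

/-- The pairs of a node and a letter along which the node has a child. -/
noncomputable def edges (T : List (Fin σ)) : Finset (Finset ℕ × Fin σ) :=
  open Classical in (nodes T ×ˢ Finset.univ).filter fun e =>
    (occurrences (label T e.1 ++ [e.2]) T).Nonempty

theorem mem_edges {e : Finset ℕ × Fin σ} :
    e ∈ edges T ↔ e.1 ∈ nodes T ∧ (occurrences (label T e.1 ++ [e.2]) T).Nonempty := by
  simp [edges]

theorem child_mem_nodes {e : Finset ℕ × Fin σ} (he : e ∈ edges T) :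
    occurrences (label T e.1 ++ [e.2]) T ∈ nodes T :=
  mem_nodes.2 ⟨(mem_edges.1 he).2, _, rfl⟩

/-- Every node is the child along at most one edge; hence there are fewer edges than nodes. -/
theorem child_injOn : Set.InjOn (fun e : Finset ℕ × Fin σ => occurrences (label T e.1 ++ [e.2]) T)
    (edges T) := by
  have aux : ∀ e ∈ edges T, ∀ f ∈ edges T,
      occurrences (label T e.1 ++ [e.2]) T = occurrences (label T f.1 ++ [f.2]) T →
      (label T f.1).length ≤ (label T e.1).length := by
    intro e he f hf h
    by_contra hlt
    push Not at hlt
    obtain ⟨i, hi⟩ := (mem_edges.1 he).2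
    have h1 := (mem_occurrences.1 hi).2
    rw [h] at hi
    have h2 := (mem_occurrences.1 (occurrences_anti (List.prefix_append _ _) hi)).2
    have h3 : label T e.1 ++ [e.2] <+: label T f.1 :=
      List.prefix_of_prefix_length_le h1 h2 (by simpa using hlt)
    have h4 : occurrences (label T f.1 ++ [f.2]) T = occurrences (label T f.1) T := by
      refine Finset.Subset.antisymm (occurrences_anti (List.prefix_append _ _)) ?_
      rw [← h]
      exact occurrences_anti h3
    have hf1 := (mem_edges.1 hf).1
    have := (prefix_label hf1 (h4.trans (occurrences_label hf1))).length_le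
    simp at this
  intro e he f hf h
  have hl := le_antisymm (aux f hf e he h.symm) (aux e he f hf h)
  obtain ⟨i, hi⟩ := (mem_edges.1 he).2
  have h1 := (mem_occurrences.1 hi).2
  simp only at h
  rw [h] at hi
  have h2 := (mem_occurrences.1 hi).2
  have h3 : label T e.1 ++ [e.2] = label T f.1 ++ [f.2] :=
    (List.prefix_of_prefix_length_le h1 h2 (by simp [hl])).eq_of_length (by simp [hl])
  obtain ⟨h4, h5⟩ := List.append_inj h3 hl
  have h6 : e.1 = f.1 := by
    rw [← occurrences_label (mem_edges.1 he).1, h4, occurrences_label (mem_edges.1 hf).1]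
  exact Prod.ext h6 (by simpa using h5)

theorem card_edges_le : (edges T).card ≤ 2 * (T.length + 1) :=
  (Finset.card_le_card_of_injOn _ (fun _ h => child_mem_nodes h) child_injOn).trans card_nodes_le

theorem edges_nonempty (hT : T ≠ []) : (edges T).Nonempty := by
  obtain ⟨a, t, rfl⟩ := List.exists_cons_of_ne_nil hT
  set T := a :: t
  have hr : Finset.range (T.length + 1) ∈ nodes T := range_mem_nodes
  have hl : label T (Finset.range (T.length + 1)) = [] := by
    have := length_add_le_of_mem_occurrences (T := T) (P := label T (Finset.range (T.length + 1)))
      (i := T.length) (by rw [occurrences_label hr]; simp)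
    exact List.eq_nil_of_length_eq_zero (by omega)
  refine ⟨(Finset.range (T.length + 1), a), mem_edges.2 ⟨hr, 0, ?_⟩⟩
  rw [hl, mem_occurrences]
  exact ⟨by omega, t, rfl⟩

/-- The words with prefix `w` form an interval of the lexicographic order. -/
theorem prefix_of_not_lt_of_not_lt {w u v x : List (Fin σ)} (hu : w <+: u) (hx : w <+: x)
    (huv : ¬ v < u) (hvx : ¬ x < v) : w <+: v := by
  induction w generalizing u v x with
  | nil => exact List.nil_prefix
  | cons a w ih =>
    obtain ⟨u, rfl⟩ := hu
    obtain ⟨x, rfl⟩ := hx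
    cases v with
    | nil => exact absurd (List.nil_lt_cons _ _) huv
    | cons b v =>
      rw [List.cons_append, List.cons_lt_cons_iff] at huv hvx
      push Not at huv hvx
      obtain rfl : a = b := le_antisymm huv.1 hvx.1
      exact (List.prefix_cons_inj _).2 (ih (List.prefix_append _ _) (List.prefix_append _ _)
        (not_lt.2 (huv.2 rfl)) (not_lt.2 (hvx.2 rfl)))

/-- The suffix array: listing the positions by the lexicographic order of their suffixes makes
every node an interval. -/
theorem exists_suffixArray (T : List (Fin σ)) :
    ∃ sa : ℕ → ℕ, (∀ p, sa p ≤ T.length) ∧ Set.InjOn sa (Set.Iio (T.length + 1)) ∧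
      ∀ S ∈ nodes T, ∃ l, l + S.card ≤ T.length + 1 ∧
        S = (Finset.Ico l (l + S.card)).image sa := by
  classical
  let r : ℕ → ℕ → Prop := fun i j => T.drop i ≤ T.drop j
  have : Std.Total r := ⟨fun i j => le_total _ _⟩
  have : IsTrans ℕ r := ⟨fun i j k h1 h2 => le_trans (α := List (Fin σ)) h1 h2⟩
  set L := (List.range (T.length + 1)).mergeSort (r · ·) with hL
  have hpw : L.Pairwise r := List.pairwise_mergeSort' _ _
  have hperm : L.Perm (List.range (T.length + 1)) := List.mergeSort_perm _ _
  have hlen : L.length = T.length + 1 := by simpa using hperm.length_eq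
  have hnd : L.Nodup := hperm.nodup_iff.2 List.nodup_range
  have hget : ∀ p (h : p < T.length + 1), L.getD p 0 = L[p]'(by omega) := fun p h => by
    rw [List.getD_eq_getElem _ _ (by omega)]
  have hinj : Set.InjOn (fun p => L.getD p 0) (Set.Iio (T.length + 1)) := by
    intro p hp q hq h
    simp only [hget p hp, hget q hq] at h
    exact (hnd.getElem_inj_iff).1 h
  refine ⟨fun p => L.getD p 0, fun p => ?_, hinj, fun S hS => ?_⟩
  · by_cases hp : p < T.length + 1
    · have : L[p]'(by omega) ∈ List.range (T.length + 1) := hperm.mem_iff.1 (List.getElem_mem _)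
      simp only [hget p hp]
      simpa [Nat.lt_succ_iff] using this
    · have : L.getD p 0 = 0 := List.getD_eq_default _ _ (by omega)
      exact this.trans_le (Nat.zero_le _)
  · obtain ⟨hne, w, hw⟩ := mem_nodes.1 hS
    set I := (Finset.range (T.length + 1)).filter fun p => L.getD p 0 ∈ S with hI
    have hSI : S = I.image fun p => L.getD p 0 := by
      ext x
      simp only [hI, Finset.mem_image, Finset.mem_filter, Finset.mem_range]
      constructor
      · intro hx
        have hxL : x ∈ L := hperm.mem_iff.2 (by simpa using subset_range_of_mem_nodes hS hx)
        obtain ⟨p, hp, rfl⟩ := List.getElem_of_mem hxL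
        have e := hget p (by omega)
        exact ⟨p, ⟨by omega, by rw [e]; exact hx⟩, e⟩
      · rintro ⟨p, ⟨-, h⟩, rfl⟩
        exact h
    have hcard : I.card = S.card := by
      conv_rhs => rw [hSI]
      refine (Finset.card_image_of_injOn fun p hp q hq h => hinj ?_ ?_ h).symm
      · exact Finset.mem_range.1 (Finset.mem_filter.1 hp).1
      · exact Finset.mem_range.1 (Finset.mem_filter.1 hq).1
    have hIne : I.Nonempty := by rw [← Finset.card_pos, hcard]; exact hne.card_pos
    have hconv : ∀ p ∈ I, ∀ q ∈ I, ∀ s, p ≤ s → s ≤ q → s ∈ I := by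
      intro p hp q hq s hps hsq
      simp only [hI, Finset.mem_filter, Finset.mem_range] at hp hq ⊢
      have hs : s < T.length + 1 := by omega
      refine ⟨hs, ?_⟩
      rcases eq_or_lt_of_le hps with rfl | hps
      · exact hp.2
      rcases eq_or_lt_of_le hsq with rfl | hsq
      · exact hq.2
      rw [← hw, mem_occurrences] at hp hq ⊢
      rw [hget _ hp.1] at hp
      rw [hget _ hq.1] at hq
      rw [hget _ hs]
      have hs' : L[s]'(by omega) ∈ List.range (T.length + 1) :=
        hperm.mem_iff.1 (List.getElem_mem _)
      have h1 : r (L[p]'(by omega)) (L[s]'(by omega)) := List.pairwise_iff_getElem.1 hpw _ _ _ _ hps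
      have h2 : r (L[s]'(by omega)) (L[q]'(by omega)) := List.pairwise_iff_getElem.1 hpw _ _ _ _ hsq
      exact ⟨by simpa [Nat.lt_succ_iff] using hs',
        prefix_of_not_lt_of_not_lt hp.2.2 hq.2.2 (not_lt.2 h1) (not_lt.2 h2)⟩
    have hIcc : I = Finset.Ico (I.min' hIne) (I.max' hIne + 1) := by
      ext s
      rw [Finset.mem_Ico]
      constructor
      · intro hs
        exact ⟨Finset.min'_le _ _ hs, Nat.lt_succ_of_le (Finset.le_max' _ _ hs)⟩
      · rintro ⟨h1, h2⟩
        exact hconv _ (Finset.min'_mem _ hIne) _ (Finset.max'_mem _ hIne) s h1 (by omega)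
    have hmm : I.min' hIne ≤ I.max' hIne := Finset.min'_le _ _ (Finset.max'_mem _ hIne)
    have hc2 : S.card = I.max' hIne + 1 - I.min' hIne := by
      rw [← hcard]; conv_lhs => rw [hIcc]
      simp
    have hlast : I.max' hIne < T.length + 1 :=
      Finset.mem_range.1 (Finset.mem_filter.1 (Finset.max'_mem I hIne)).1
    have he : I.min' hIne + S.card = I.max' hIne + 1 := by omega
    refine ⟨I.min' hIne, by omega, ?_⟩
    rw [he, ← hIcc]
    exact hSI

end Occurrences

/-! ### Perfect hashing -/

section Hashing

/-- Two keys collide under at most a `2 / s` fraction of the multipliers. -/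
theorem card_collision_le {p s x y : ℕ} (hp : p.Prime) (hx : x < p) (hyx : y < x) :
    s * ((Finset.Ico 1 p).filter fun k => x * k % p % s = y * k % p % s).card ≤ 2 * (p - 1) := by
  rcases Nat.eq_zero_or_pos s with rfl | hs
  · simp
  have hd0 : x - y ≠ 0 := by omega
  have hndvd : ∀ k ∈ Finset.Ico 1 p, ¬ p ∣ (x - y) * k := by
    intro k hk h
    rw [Finset.mem_Ico] at hk
    rcases hp.dvd_mul.1 h with h | h
    · have := Nat.le_of_dvd (by omega) h; omega
    · have := Nat.le_of_dvd (by omega) h; omega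
  let A := (Finset.Ioc 0 (p - 1)).filter fun z => s ∣ z
  have hA : A.card = (p - 1) / s := Nat.Ioc_filter_dvd_card_eq_div _ _
  -- as `k` varies, the residue of `(x - y) * k` runs injectively, and a collision forces `s` to
  -- divide it or its negative
  have key : ((Finset.Ico 1 p).filter fun k => x * k % p % s = y * k % p % s).card
      ≤ (A ∪ A.image fun z => p - z).card := by
    refine Finset.card_le_card_of_injOn (fun k => (x - y) * k % p) ?_ ?_
    · intro k hk
      obtain ⟨hk, hcol⟩ := Finset.mem_filter.1 hk
      have hpos : 0 < (x - y) * k % p :=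
        Nat.pos_of_ne_zero fun h => hndvd k hk (Nat.dvd_of_mod_eq_zero h)
      have hlt : (x - y) * k % p < p := Nat.mod_lt _ hp.pos
      have hu : x * k % p < p := Nat.mod_lt _ hp.pos
      have hv : y * k % p < p := Nat.mod_lt _ hp.pos
      have hsum : ((x - y) * k % p + y * k % p) % p = x * k % p := by
        rw [← Nat.add_mod, ← Nat.add_mul, Nat.sub_add_cancel hyx.le]
      set z := (x - y) * k % p
      set u := x * k % p
      set v := y * k % p
      -- `u = z + v` or `u + p = z + v`
      change z ∈ _
      rw [Finset.mem_coe, Finset.mem_union, Finset.mem_image]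
      rcases lt_or_ge (z + v) p with h | h
      · rw [Nat.mod_eq_of_lt h] at hsum
        left
        refine Finset.mem_filter.2 ⟨Finset.mem_Ioc.2 ⟨hpos, by omega⟩, ?_⟩
        have : z = u - v := by omega
        rw [this]
        exact (Nat.modEq_iff_dvd' (by omega)).1 hcol.symm
      · rw [Nat.mod_eq_sub_mod h, Nat.mod_eq_of_lt (by omega)] at hsum
        right
        refine ⟨p - z, Finset.mem_filter.2 ⟨Finset.mem_Ioc.2 ⟨by omega, by omega⟩, ?_⟩, by omega⟩
        have : p - z = v - u := by omega
        rw [this]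
        exact (Nat.modEq_iff_dvd' (by omega)).1 hcol
    · intro k hk l hl h
      have hk := (Finset.mem_filter.1 hk).1
      have hl := (Finset.mem_filter.1 hl).1
      rw [Finset.mem_Ico] at hk hl
      have hcop : Nat.gcd p (x - y) = 1 :=
        (hp.coprime_iff_not_dvd).2 fun h => by have := Nat.le_of_dvd (by omega) h; omega
      have : k ≡ l [MOD p] := Nat.ModEq.cancel_left_of_coprime hcop h
      rwa [Nat.ModEq, Nat.mod_eq_of_lt hk.2, Nat.mod_eq_of_lt hl.2] at this
  have h2 : (A ∪ A.image fun z => p - z).card ≤ 2 * ((p - 1) / s) := by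
    have := Finset.card_union_le A (A.image fun z => p - z)
    have := Finset.card_image_le (s := A) (f := fun z => p - z)
    omega
  calc _ ≤ s * (2 * ((p - 1) / s)) := Nat.mul_le_mul_left _ (key.trans h2)
    _ = 2 * (s * ((p - 1) / s)) := by ring
    _ ≤ 2 * (p - 1) := Nat.mul_le_mul_left _ (Nat.mul_div_le _ _)

/-- Some multiplier does not exceed the average number of collisions. -/
theorem exists_multiplier (X : Finset ℕ) {p : ℕ} (hp : p.Prime) (hX : ∀ x ∈ X, x < p) (s : ℕ) :
    ∃ k < p, s * (X.offDiag.filter fun e => e.1 * k % p % s = e.2 * k % p % s).card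
      ≤ 2 * X.offDiag.card := by
  have hne : (Finset.Ico 1 p).Nonempty := ⟨1, Finset.mem_Ico.2 ⟨le_rfl, hp.one_lt⟩⟩
  have hsum : ∑ k ∈ Finset.Ico 1 p,
      s * (X.offDiag.filter fun e => e.1 * k % p % s = e.2 * k % p % s).card
        ≤ ∑ _k ∈ Finset.Ico 1 p, 2 * X.offDiag.card := by
    calc _ = ∑ e ∈ X.offDiag,
          s * ((Finset.Ico 1 p).filter fun k => e.1 * k % p % s = e.2 * k % p % s).card := by
          simp only [Finset.card_filter, Finset.mul_sum]
          exact Finset.sum_comm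
      _ ≤ ∑ _e ∈ X.offDiag, 2 * (p - 1) := by
          refine Finset.sum_le_sum fun e he => ?_
          obtain ⟨h1, h2, h3⟩ := Finset.mem_offDiag.1 he
          rcases lt_or_gt_of_ne h3 with h | h
          · have := card_collision_le (s := s) hp (hX _ h2) h
            simpa only [eq_comm] using this
          · exact card_collision_le hp (hX _ h1) h
      _ = _ := by simp; ring
  obtain ⟨k, hk, h⟩ := Finset.exists_le_of_sum_le hne hsum
  exact ⟨k, (Finset.mem_Ico.1 hk).2, h⟩

/-- The two-level scheme of Fredman, Komlós and Szemerédi.  The first level distributes the keys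
over `X.card` buckets; a bucket with `b` keys has `2 * b ^ 2 + 1` cells of its own, which suffices
for an injective second level. -/
theorem exists_perfectHash (X : Finset ℕ) {p : ℕ} (hp : p.Prime) (hX : ∀ x ∈ X, x < p) :
    ∃ (k : ℕ) (k' sz off : ℕ → ℕ), k < p ∧ (∀ h, k' h < p) ∧ (∀ h, 0 < sz h) ∧
      (∀ h < X.card, off h + sz h ≤ 7 * X.card) ∧
      Set.InjOn (fun x => off (x * k % p % X.card) +
        x * k' (x * k % p % X.card) % p % sz (x * k % p % X.card)) X := by
  obtain ⟨k, hkp, hk⟩ := exists_multiplier X hp hX X.card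
  let hash : ℕ → ℕ := fun x => x * k % p % X.card
  let b : ℕ → Finset ℕ := fun h => X.filter fun x => hash x = h
  have hbX : ∀ h, ∀ x ∈ b h, x < p := fun h x hx => hX x (Finset.mem_filter.1 hx).1
  let sz : ℕ → ℕ := fun h => 2 * (b h).card ^ 2 + 1
  have hex : ∀ h, ∃ k' < p, Set.InjOn (fun x => x * k' % p % sz h) (b h) := by
    intro h
    obtain ⟨k', hk'p, hk'⟩ := exists_multiplier (b h) hp (hbX h) (sz h)
    refine ⟨k', hk'p, fun x hx y hy hxy => ?_⟩
    by_contra hne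
    have h1 : 0 < ((b h).offDiag.filter
        fun e => e.1 * k' % p % sz h = e.2 * k' % p % sz h).card :=
      Finset.card_pos.2 ⟨(x, y), Finset.mem_filter.2 ⟨Finset.mem_offDiag.2 ⟨hx, hy, hne⟩, hxy⟩⟩
    have h2 : sz h ≤ 2 * (b h).offDiag.card := (Nat.le_mul_of_pos_right _ h1).trans hk'
    have h3 : (b h).offDiag.card ≤ (b h).card ^ 2 := by
      rw [Finset.offDiag_card, sq]; exact Nat.sub_le _ _
    simp only [sz] at h2
    omega
  choose k' hk'p hk' using hex
  have hmono : ∀ {h m}, h < m → (∑ i ∈ Finset.range h, sz i) + sz h ≤ ∑ i ∈ Finset.range m, sz i := by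
    intro h m hm
    rw [← Finset.sum_range_succ]
    exact Finset.sum_le_sum_of_subset (Finset.range_subset_range.2 hm)
  have hsz : ∑ i ∈ Finset.range X.card, sz i ≤ 7 * X.card := by
    rcases Nat.eq_zero_or_pos X.card with h0 | h0
    · simp [h0]
    have hpairs : ∑ i ∈ Finset.range X.card, (b i).card ^ 2
        = ((X ×ˢ X).filter fun e => hash e.1 = hash e.2).card := by
      rw [Finset.card_eq_sum_card_fiberwise (f := fun e : ℕ × ℕ => hash e.1)
        (t := Finset.range X.card)]
      · refine Finset.sum_congr rfl fun i _ => ?_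
        rw [sq, ← Finset.card_product]
        congr 1
        ext ⟨x, y⟩
        simp only [b, Finset.mem_product, Finset.mem_filter]
        constructor
        · rintro ⟨⟨h1, h2⟩, h3, h4⟩
          exact ⟨⟨⟨h1, h3⟩, h2.trans h4.symm⟩, h2⟩
        · rintro ⟨⟨⟨h1, h2⟩, h3⟩, h4⟩
          exact ⟨⟨h1, h4⟩, h2, h3.symm.trans h4⟩
      · intro e _
        simpa [hash] using Nat.mod_lt _ h0
    have hsplit : ((X ×ˢ X).filter fun e => hash e.1 = hash e.2).card
        ≤ X.card + (X.offDiag.filter fun e => hash e.1 = hash e.2).card := by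
      rw [← Finset.diag_union_offDiag, Finset.filter_union]
      refine (Finset.card_union_le _ _).trans (Nat.add_le_add_right ?_ _)
      exact (Finset.card_filter_le _ _).trans (by simp)
    have hcol : (X.offDiag.filter fun e => hash e.1 = hash e.2).card ≤ 2 * X.card := by
      have h1 : X.offDiag.card ≤ X.card * X.card := by
        rw [Finset.offDiag_card]; exact Nat.sub_le _ _
      have h2 : X.card * (X.offDiag.filter fun e => hash e.1 = hash e.2).card
          ≤ X.card * (2 * X.card) := by
        calc _ ≤ 2 * X.offDiag.card := hk
          _ ≤ 2 * (X.card * X.card) := by omega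
          _ = _ := by ring
      exact Nat.le_of_mul_le_mul_left h2 h0
    simp only [sz, Finset.sum_add_distrib, ← Finset.mul_sum, hpairs, Finset.sum_const,
      Finset.card_range, smul_eq_mul, mul_one]
    omega
  refine ⟨k, k', sz, fun h => ∑ i ∈ Finset.range h, sz i, hkp, hk'p, fun h => Nat.succ_pos _,
    fun h hh => (hmono hh).trans hsz, ?_⟩
  intro x hx y hy hxy
  change (∑ i ∈ Finset.range (hash x), sz i) + x * k' (hash x) % p % sz (hash x) =
    (∑ i ∈ Finset.range (hash y), sz i) + y * k' (hash y) % p % sz (hash y) at hxy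
  have h1 : x * k' (hash x) % p % sz (hash x) < sz (hash x) := Nat.mod_lt _ (Nat.succ_pos _)
  have h2 : y * k' (hash y) % p % sz (hash y) < sz (hash y) := Nat.mod_lt _ (Nat.succ_pos _)
  rcases lt_trichotomy (hash x) (hash y) with h | h | h
  · have := hmono h; omega
  · rw [h] at hxy
    refine hk' (hash y) ?_ ?_ (Nat.add_left_cancel hxy)
    · exact Finset.mem_coe.2 (Finset.mem_filter.2 ⟨hx, h⟩)
    · exact Finset.mem_coe.2 (Finset.mem_filter.2 ⟨hy, rfl⟩)
  · have := hmono h; omega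

end Hashing

/-! ### Packed arrays -/

section Packing

/-- `q` digits to the base `N` fit in one word below `N ^ q`. -/
theorem exists_packed (N : ℕ) (d : ℕ → ℕ) (hd : ∀ r, d r < N) (q : ℕ) :
    ∃ w < N ^ q, ∀ r < q, w / N ^ r % N = d r := by
  induction q with
  | zero => exact ⟨0, by simp, by simp⟩
  | succ q ih =>
    obtain ⟨w, hw, h⟩ := ih
    have hN : 0 < N := lt_of_le_of_lt (Nat.zero_le _) (hd 0)
    refine ⟨w + N ^ q * d q, ?_, fun r hr => ?_⟩
    · calc w + N ^ q * d q < N ^ q + N ^ q * d q := by omega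
        _ = N ^ q * (d q + 1) := by ring
        _ ≤ N ^ q * N := Nat.mul_le_mul_left _ (hd q)
        _ = N ^ (q + 1) := by ring
    · rcases Nat.lt_succ_iff_lt_or_eq.1 hr with hr | rfl
      · rw [← h r hr]
        obtain ⟨e, rfl⟩ := Nat.exists_eq_add_of_lt hr
        have : w + N ^ (r + e + 1) * d (r + e + 1) = w + N ^ r * (N * (N ^ e * d (r + e + 1))) := by
          ring
        rw [this, Nat.add_mul_div_left _ _ (pow_pos hN r), Nat.add_mul_mod_self_left]
      · rw [Nat.add_mul_div_left _ _ (pow_pos hN r), Nat.div_eq_of_lt hw, zero_add,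
          Nat.mod_eq_of_lt (hd r)]

/-- Rows of lengths `len 0, …, len (m - 1)` written one after the other into a single array. -/
theorem exists_concat (m : ℕ) (len : ℕ → ℕ) (c : ℕ → ℕ → ℕ) {b : ℕ} (hb : 0 < b)
    (hc : ∀ i < m, ∀ t < len i, c i t < b) :
    ∃ (A : ℕ → ℕ) (off : ℕ → ℕ), (∀ a, A a < b) ∧
      (∀ i < m, off i + len i ≤ ∑ i ∈ Finset.range m, len i) ∧
      ∀ i < m, ∀ t < len i, A (off i + t) = c i t := by
  induction m with
  | zero => exact ⟨fun _ => 0, fun _ => 0, fun _ => hb, by simp, by simp⟩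
  | succ m ih =>
    obtain ⟨A, off, h1, h2, h3⟩ := ih fun i hi => hc i (by omega)
    set s := ∑ i ∈ Finset.range m, len i with hs
    refine ⟨fun a => if a < s then A a else if a - s < len m then c m (a - s) else 0,
      fun i => if i < m then off i else s, fun a => ?_, fun i hi => ?_, fun i hi t ht => ?_⟩
    · dsimp only
      split_ifs with h h'
      · exact h1 a
      · exact hc m (by omega) _ h'
      · exact hb
    · rw [Finset.sum_range_succ, ← hs]
      dsimp only
      split_ifs with h
      · have := h2 i h; omega
      · obtain rfl : i = m := by omega
        exact le_rfl
    · dsimp only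
      by_cases h : i < m
      · have := h2 i h
        rw [if_pos h, if_pos (by omega), h3 i h t ht]
      · obtain rfl : i = m := by omega
        rw [if_neg h, if_neg (by omega), Nat.add_sub_cancel_left, if_pos ht]

end Packing

/-! ### Rank keys at doubly exponential levels -/

/-- The radix of level `j`; the keys of this level have two digits. -/
def radix (j : ℕ) : ℕ := 2 ^ 2 ^ j

theorem radix_pos (j : ℕ) : 0 < radix j := by simp [radix]

theorem radix_succ (j : ℕ) : radix (j + 1) = radix j * radix j := by
  simp only [radix]; rw [← pow_add, pow_succ, mul_two]

theorem lt_radix (j : ℕ) : 2 ^ j < radix j := Nat.lt_two_pow_self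

/-- The least level whose keys can rank `k` elements; by minimality its radix is `O(k)`, so that
bucket sort with this radix takes linear time. -/
theorem exists_level (k : ℕ) : ∃ j, k ≤ radix j * radix j ∧ (1 ≤ k → radix j ≤ 2 * k) ∧
    ∀ i, k ≤ radix i * radix i → j ≤ i := by
  classical
  have hex : ∃ j, k ≤ radix j * radix j := by
    refine ⟨k, ?_⟩
    have h1 := lt_radix k
    have h2 : k < 2 ^ k := Nat.lt_two_pow_self
    nlinarith
  have hle : 1 ≤ k → radix (Nat.find hex) ≤ 2 * k := by
    intro hk
    rcases h : Nat.find hex with _ | i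
    · simp [radix]; omega
    · have h1 := Nat.find_min hex (m := i) (by omega)
      rw [radix_succ]; omega
  refine ⟨Nat.find hex, Nat.find_spec hex, hle, fun i hi => Nat.find_min' hex hi⟩

/-- The packed key tables.  With `N` entries in all, level `j` stores `q = 2 ^ (J - j)` keys to
the word, so that its words are below `(2 * N) ^ 2` and the levels together take `O(N)` words. -/
theorem exists_levels {N : ℕ} (hN : 0 < N) (key : ℕ → ℕ → ℕ)
    (hkey : ∀ j p, key j p < radix j * radix j) :
    ∃ (words powers : ℕ → ℕ) (q woff poff : ℕ → ℕ),
      (∀ a, words a < (2 * N) ^ 2) ∧ (∀ a, powers a < (2 * N) ^ 2) ∧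
      ∀ k, 1 ≤ k → k ≤ N → ∃ j, k ≤ radix j * radix j ∧ radix j ≤ 2 * k ∧
        q j ≤ 2 * N ∧ ∀ p < N, woff j + p / q j < 8 * N ∧ poff j + p % q j < 8 * N ∧
          words (woff j + p / q j) / powers (poff j + p % q j) % (radix j * radix j) = key j p := by
  obtain ⟨J, hJ, hJle', hJmin⟩ := exists_level N
  have hJle := hJle' hN
  have hJN : 2 ^ J < 2 * N := (lt_radix J).trans_le hJle
  have hpow : ∀ j ≤ J, (radix j * radix j) ^ 2 ^ (J - j) = radix J * radix J := by
    intro j hj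
    rw [← radix_succ, ← radix_succ, radix, radix, ← pow_mul, ← pow_add]
    congr 2; omega
  have hbound : radix J * radix J ≤ (2 * N) ^ 2 := by
    rw [sq]; exact Nat.mul_le_mul hJle hJle
  have hlt : ∀ j ≤ J, ∀ r < 2 ^ (J - j), (radix j * radix j) ^ r < radix J * radix J := by
    intro j hj r hr
    rw [← hpow j hj]
    have : 2 ≤ radix j := by
      have := lt_radix j; have := Nat.one_le_two_pow (n := j); omega
    exact Nat.pow_lt_pow_right (by nlinarith) hr
  have hw : ∀ j t, ∃ w < (radix j * radix j) ^ 2 ^ (J - j), ∀ r < 2 ^ (J - j),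
      w / (radix j * radix j) ^ r % (radix j * radix j) = key j (2 ^ (J - j) * t + r) :=
    fun j t => exists_packed _ (fun r => key j (2 ^ (J - j) * t + r)) (fun r => hkey _ _) _
  choose w hw1 hw2 using hw
  have hb : 0 < (2 * N) ^ 2 := by positivity
  obtain ⟨words, woff, a1, a2, a3⟩ := exists_concat (J + 1) (fun j => N / 2 ^ (J - j) + 1) w hb
    fun i hi t ht => (hw1 i t).trans_le ((hpow i (by omega)).le.trans hbound)
  obtain ⟨powers, poff, b1, b2, b3⟩ := exists_concat (J + 1) (fun j => 2 ^ (J - j))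
    (fun j r => (radix j * radix j) ^ r) hb
    fun i hi r hr => (hlt i (by omega) r hr).trans_le hbound
  have hgeo : ∑ j ∈ Finset.range (J + 1), 2 ^ (J - j) ≤ 2 * 2 ^ J := by
    have h1 := Finset.sum_range_reflect (fun i => 2 ^ i) (J + 1)
    have h2 : ∑ j ∈ Finset.range (J + 1), 2 ^ j < 2 * 2 ^ J := by
      have := Nat.geomSum_lt (m := 2) (n := J + 1) (s := Finset.range (J + 1)) le_rfl (by simp)
      rwa [pow_succ, mul_comm] at this
    calc _ = ∑ j ∈ Finset.range (J + 1), 2 ^ (J + 1 - 1 - j) := by simp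
      _ = ∑ j ∈ Finset.range (J + 1), 2 ^ j := h1
      _ ≤ _ := h2.le
  have hdiv : ∑ j ∈ Finset.range (J + 1), (N / 2 ^ (J - j) + 1) ≤ 4 * N := by
    have h1 := Finset.sum_range_reflect (fun i => N / 2 ^ i + 1) (J + 1)
    have h2 : ∑ i ∈ Finset.range (J + 1), N / 2 ^ i ≤ 2 * N := by
      have := Nat.geom_sum_le le_rfl N (J + 1) (b := 2)
      omega
    have h3 : J < 2 ^ J := Nat.lt_two_pow_self
    calc _ = ∑ j ∈ Finset.range (J + 1), (N / 2 ^ (J + 1 - 1 - j) + 1) := by simp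
      _ = ∑ j ∈ Finset.range (J + 1), (N / 2 ^ j + 1) := h1
      _ ≤ _ := by
        rw [Finset.sum_add_distrib]; simp only [Finset.sum_const, Finset.card_range, smul_eq_mul]
        omega
  refine ⟨words, powers, fun j => 2 ^ (J - j), woff, poff, a1, b1, fun k hk1 hkN => ?_⟩
  obtain ⟨j, hj1, hj2, hj3⟩ := exists_level k
  have hjJ : j ≤ J := hj3 J (hkN.trans hJ)
  have hq : 0 < 2 ^ (J - j) := by positivity
  refine ⟨j, hj1, hj2 hk1, ?_, fun p hp => ?_⟩
  · exact (Nat.pow_le_pow_right (by norm_num) (Nat.sub_le _ _)).trans hJN.le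
  have e1 : p / 2 ^ (J - j) < N / 2 ^ (J - j) + 1 :=
    Nat.lt_succ_of_le (Nat.div_le_div_right hp.le)
  have e2 : p % 2 ^ (J - j) < 2 ^ (J - j) := Nat.mod_lt _ hq
  have e3 := a2 j (by omega)
  have e4 := b2 j (by omega)
  dsimp only
  refine ⟨by omega, by omega, ?_⟩
  rw [a3 j (by omega) _ e1, b3 j (by omega) _ e2, hw2 j _ _ e2, Nat.div_add_mod]

/-! ### Verification of word RAM programs -/

namespace WordRAM

/-- A configuration whose registers are listed in `L` (the others hold `0`) and whose memory of
`M` cells is the restriction of `f`. -/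
def state (M pc : ℕ) (L : List ℕ) (f : ℕ → ℕ) (inp out : List ℕ) : Config :=
  ⟨pc, fun r => L.getD r 0, (List.range M).map f, inp, out⟩

/-- From `c` a configuration with property `Q` is reached within `t` steps. -/
def Reaches (B : ℕ) (prog : List Instr) (Q : Config → Prop) (t : ℕ) (c : Config) : Prop :=
  ∃ t' ≤ t, ∃ c', run B prog t' c = some c' ∧ Q c'

/-- Weakest precondition of a straight-line block. -/
def wp (B M : ℕ) : List Instr → List ℕ → (ℕ → ℕ) → (List ℕ → (ℕ → ℕ) → Prop) → Prop
  | [], L, f, R => R L f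
  | .const r k :: is, L, f, R => r < L.length ∧ k < B ∧ wp B M is (L.set r k) f R
  | .op o r s t :: is, L, f, R => r < L.length ∧ o.eval (L.getD s 0) (L.getD t 0) < B ∧
      wp B M is (L.set r (o.eval (L.getD s 0) (L.getD t 0))) f R
  | .load r s :: is, L, f, R => r < L.length ∧ L.getD s 0 < M ∧ f (L.getD s 0) < B ∧
      wp B M is (L.set r (f (L.getD s 0))) f R
  | .store s r :: is, L, f, R => L.getD s 0 < M ∧
      wp B M is L (Function.update f (L.getD s 0) (L.getD r 0)) R
  | _ :: _, _, _, _ => False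

section Rules

variable {B M pc t : ℕ} {prog : List Instr} {Q : Config → Prop} {L : List ℕ} {f : ℕ → ℕ}
  {inp out : List ℕ}

theorem Reaches.mono {t' : ℕ} {c : Config} (h : Reaches B prog Q t c) (htt' : t ≤ t') :
    Reaches B prog Q t' c := by
  obtain ⟨s, hs, h⟩ := h
  exact ⟨s, hs.trans htt', h⟩

theorem Reaches.refl {c : Config} (h : Q c) : Reaches B prog Q t c :=
  ⟨0, Nat.zero_le _, c, rfl, h⟩

theorem Reaches.step {c c' : Config} (hc : WordRAM.step B prog c = some c')
    (h : Reaches B prog Q t c') : Reaches B prog Q (t + 1) c := by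
  obtain ⟨s, hs, d, hd, hQ⟩ := h
  exact ⟨s + 1, Nat.succ_le_succ hs, d, by rw [run, hc, Option.bind_some, hd], hQ⟩

theorem update_getD {r : ℕ} (hr : r < L.length) (v : ℕ) :
    Function.update (fun i => L.getD i 0) r v = fun i => (L.set r v).getD i 0 := by
  funext i
  rcases eq_or_ne i r with rfl | h
  · simp [List.getD_eq_getElem?_getD, hr]
  · simp [List.getD_eq_getElem?_getD, Function.update_of_ne h, List.getElem?_set_ne h.symm]

theorem set_map_range {a : ℕ} (v : ℕ) :
    ((List.range M).map f).set a v = (List.range M).map (Function.update f a v) := by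
  refine List.ext_getElem (by simp) fun i h1 h2 => ?_
  rw [List.getElem_set]
  rcases eq_or_ne a i with rfl | h
  · simp
  · simp [h, Function.update_of_ne h.symm]

theorem put_state {r v : ℕ} (hr : r < L.length) (hv : v < B) :
    (state M pc L f inp out).put B r v = some (state M (pc + 1) (L.set r v) f inp out) := by
  simp only [state, Config.put, if_pos hv, update_getD hr]

theorem Reaches.block_aux {R : List ℕ → (ℕ → ℕ) → Prop} (code : List Instr) :
    ∀ pc L f, (prog.drop pc).take code.length = code → wp B M code L f R →
      (∀ L' f', R L' f' → Reaches B prog Q t (state M (pc + code.length) L' f' inp out)) →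
      Reaches B prog Q (t + code.length) (state M pc L f inp out) := by
  induction code with
  | nil => exact fun pc L f _ h hR => hR L f h
  | cons i is ih =>
    intro pc L f hcode h hR
    obtain ⟨hi, his⟩ : prog[pc]? = some i ∧ (prog.drop (pc + 1)).take is.length = is := by
      have h0 := congrArg (fun l => l[0]?) hcode
      have h1 := congrArg List.tail hcode
      simp only [List.length_cons] at h0 h1
      constructor
      · simpa [List.getElem?_take] using h0
      · rw [← List.drop_one, List.drop_take, List.drop_drop] at h1
        simpa using h1
    have e : pc + (i :: is).length = pc + 1 + is.length := by simp; omega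
    rw [e] at hR
    rw [List.length_cons, ← add_assoc]
    cases i with
    | const r k =>
      obtain ⟨h1, h2, h3⟩ := h
      refine Reaches.step ?_ (ih _ _ _ his h3 hR)
      simp only [WordRAM.step]
      rw [show (state M pc L f inp out).pc = pc from rfl, hi]
      exact put_state h1 h2
    | op o r s u =>
      obtain ⟨h1, h2, h3⟩ := h
      refine Reaches.step ?_ (ih _ _ _ his h3 hR)
      simp only [WordRAM.step]
      rw [show (state M pc L f inp out).pc = pc from rfl, hi]
      exact put_state h1 h2
    | load r s =>
      obtain ⟨h1, h2, h3, h4⟩ := h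
      refine Reaches.step ?_ (ih _ _ _ his h4 hR)
      simp only [WordRAM.step]
      rw [show (state M pc L f inp out).pc = pc from rfl, hi]
      have : (state M pc L f inp out).mem[(state M pc L f inp out).reg s]?
          = some (f (L.getD s 0)) := by
        simp only [state]
        rw [List.getElem?_map, List.getElem?_range h2]; rfl
      simp only [this]
      exact put_state h1 h3
    | store s r =>
      obtain ⟨h1, h2⟩ := h
      refine Reaches.step ?_ (ih _ _ _ his h2 hR)
      simp only [WordRAM.step]
      rw [show (state M pc L f inp out).pc = pc from rfl, hi]
      have : (state M pc L f inp out).reg s < (state M pc L f inp out).mem.length := by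
        simpa [state] using h1
      simp only [if_pos this]
      simp only [state, set_map_range]
    | jump => exact h.elim
    | jlt => exact h.elim
    | read => exact h.elim
    | write => exact h.elim
    | halt => exact h.elim

theorem Reaches.block (code : List Instr) (n : ℕ) (hn : code.length = n)
    (hcode : (prog.drop pc).take n = code)
    (h : wp B M code L f fun L' f' => Reaches B prog Q t (state M (pc + n) L' f' inp out)) :
    Reaches B prog Q (t + n) (state M pc L f inp out) := by
  subst hn
  exact Reaches.block_aux code pc L f hcode h fun _ _ h => h

theorem Reaches.jump {l : ℕ} (hi : prog[pc]? = some (.jump l))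
    (h : Reaches B prog Q t (state M l L f inp out)) :
    Reaches B prog Q (t + 1) (state M pc L f inp out) := by
  refine Reaches.step ?_ h
  simp only [WordRAM.step]
  rw [show (state M pc L f inp out).pc = pc from rfl, hi]
  rfl

theorem Reaches.jlt {s u l : ℕ} (hi : prog[pc]? = some (.jlt s u l))
    (h : Reaches B prog Q t
      (state M (if L.getD s 0 < L.getD u 0 then l else pc + 1) L f inp out)) :
    Reaches B prog Q (t + 1) (state M pc L f inp out) := by
  refine Reaches.step ?_ h
  simp only [WordRAM.step]
  rw [show (state M pc L f inp out).pc = pc from rfl, hi]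
  rfl

theorem Reaches.read_nil {r l : ℕ} (hi : prog[pc]? = some (.read r l))
    (h : Reaches B prog Q t (state M l L f [] out)) :
    Reaches B prog Q (t + 1) (state M pc L f [] out) := by
  refine Reaches.step ?_ h
  simp only [WordRAM.step]
  rw [show (state M pc L f [] out).pc = pc from rfl, hi]
  rfl

theorem Reaches.read_cons {r l a : ℕ} (hi : prog[pc]? = some (.read r l)) (hr : r < L.length)
    (ha : a < B) (h : Reaches B prog Q t (state M (pc + 1) (L.set r a) f inp out)) :
    Reaches B prog Q (t + 1) (state M pc L f (a :: inp) out) := by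
  refine Reaches.step ?_ h
  simp only [WordRAM.step]
  rw [show (state M pc L f (a :: inp) out).pc = pc from rfl, hi]
  exact put_state hr ha

theorem Reaches.write {s : ℕ} (hi : prog[pc]? = some (.write s))
    (h : Reaches B prog Q t (state M (pc + 1) L f inp (out ++ [L.getD s 0]))) :
    Reaches B prog Q (t + 1) (state M pc L f inp out) := by
  refine Reaches.step ?_ h
  simp only [WordRAM.step]
  rw [show (state M pc L f inp out).pc = pc from rfl, hi]
  rfl

end Rules

end WordRAM

/-! ### The query program -/

namespace SortedReporting

/-- Load the parameters of the data structure and enter the root. -/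
def initCode : List Instr :=
  [.const 0 18, .load 0 0, .const 1 38, .load 1 1, .const 2 58, .load 2 2, .const 4 78, .load 4 4,
   .const 3 98, .load 3 3, .const 6 2, .op .add 6 4 6, .load 6 6]

/-- Evaluate the two hash functions and load the key in the cell they designate. -/
def lookupCode : List Instr :=
  [.const 8 3, .op .add 8 4 8, .load 8 8, .op .add 8 8 7,
   .op .mul 9 8 0, .op .mod 9 9 1, .op .mod 9 9 2, .const 10 20, .op .mul 9 9 10,
   .const 10 10, .op .add 10 9 10, .load 10 10, .op .mul 10 8 10, .op .mod 10 10 1,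
   .const 11 11, .op .add 11 9 11, .load 11 11, .op .mod 10 10 11,
   .const 11 20, .op .mul 10 10 11,
   .const 11 12, .op .add 11 9 11, .load 11 11, .op .add 10 10 11,
   .const 11 13, .op .add 11 10 11, .load 11 11]

/-- Move to the child designated by the hash cell. -/
def childCode : List Instr :=
  [.const 4 14, .op .add 4 10 4, .load 4 4, .const 5 15, .op .add 5 10 5, .load 5 5,
   .const 6 2, .op .add 6 4 6, .load 6 6]

/-- Load the next text symbol of the edge. -/
def edgeCode : List Instr := [.load 8 5, .const 9 20, .op .add 5 5 9]

/-- Load the record of the node that is reported. -/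
def recordCode : List Instr :=
  [.const 12 4, .op .add 12 4 12, .load 12 12, .const 13 6, .op .add 13 4 13, .load 13 13,
   .const 14 7, .op .add 14 4 14, .load 14 14, .const 15 8, .op .add 15 4 15, .load 15 15,
   .const 16 9, .op .add 16 4 16, .load 16 16,
   .const 19 8, .op .mul 18 13 19, .op .add 18 18 3, .op .add 17 3 20]

/-- Empty the buckets with the number of the current record. -/
def clearCode : List Instr :=
  [.store 17 20, .const 11 1, .op .add 11 17 11, .store 11 20, .const 11 8, .op .add 17 17 11]

/-- Compute the end of the records of the items and return to the first one. -/
def countCode : List Instr :=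
  [.const 6 5, .op .add 6 4 6, .load 6 6, .const 8 8, .op .mul 6 6 8, .op .add 6 6 3,
   .op .add 17 3 20]

/-- Extract the two digits of the next key. -/
def digitsCode : List Instr :=
  [.op .div 8 12 14, .const 9 20, .op .mul 8 8 9, .op .add 8 8 15, .load 8 8,
   .op .mod 10 12 14, .op .mul 10 10 9, .op .add 10 10 16, .load 10 10,
   .op .div 8 8 10, .op .mod 10 8 13, .op .div 8 8 13, .op .mod 8 8 13]

/-- Push the next item to the bucket of its low digit. -/
def lowCode : List Instr :=
  [.const 11 8, .op .mul 8 8 11, .op .add 8 8 3, .const 11 4, .op .add 11 17 11, .store 11 8,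
   .const 11 8, .op .mul 10 10 11, .op .add 10 10 3, .load 11 10, .store 10 17,
   .const 8 2, .op .add 8 17 8, .store 8 11,
   .op .mul 8 12 9, .const 11 1, .op .add 8 8 11, .load 8 8,
   .const 10 5, .op .add 10 17 10, .store 10 8,
   .op .add 12 12 11, .const 11 8, .op .add 17 17 11]

/-- Go down to the next bucket of the low digits. -/
def prevBucketCode : List Instr := [.const 11 8, .op .sub 18 18 11, .load 8 18]

/-- Push the current item to the bucket of its high digit. -/
def highCode : List Instr :=
  [.const 9 4, .op .add 9 8 9, .load 9 9, .const 10 1, .op .add 9 9 10, .load 10 9, .store 9 8,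
   .const 9 3, .op .add 9 8 9, .store 9 10, .const 9 2, .op .add 8 8 9, .load 8 8]

/-- Compute the end of the buckets and return to the first one. -/
def outputCode : List Instr := [.const 19 8, .op .mul 6 13 19, .op .add 6 6 3, .op .add 17 3 20]

/-- Go up to the next bucket of the high digits. -/
def nextBucketCode : List Instr :=
  [.const 9 1, .op .add 8 17 9, .load 8 8, .op .add 17 17 19]

/-- The query program.  Registers `0, …, 3` hold the parameters of the hash function and the start
of the scratch space, `4` the current node, `5` and `6` the current and the last text position of
the current edge; `12, …, 19` are used for sorting, and `20` is always `0`.  Line `13` is the loop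
over the pattern, line `60` starts the report, and line `163` halts. -/
def prog : List Instr := List.flatten
  [initCode, [.read 7 60, .jlt 5 6 54], lookupCode, [.jlt 11 8 163, .jlt 8 11 163],
   childCode, [.jump 13], edgeCode, [.jlt 7 8 163, .jlt 8 7 163, .jump 13],
   recordCode, [.jlt 17 18 81, .jump 88], clearCode, [.jump 79],
   countCode, [.jlt 17 6 97, .jump 135], digitsCode, lowCode, [.jump 95],
   [.const 8 0, .jlt 20 8 143, .jlt 3 18 139, .jump 157], prevBucketCode, [.jump 136],
   highCode, [.jump 136],
   outputCode, [.jlt 20 8 169, .jlt 17 6 164, .halt], nextBucketCode, [.jump 161],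
   [.const 9 5, .op .add 9 8 9, .load 9 9], [.write 9],
   [.const 9 3, .op .add 8 8 9, .load 8 8], [.jump 161]]

/-! ### Matching the pattern -/

section Matching

variable {B M Z t : ℕ} {Q : Config → Prop} {f : ℕ → ℕ} {inp out : List ℕ}

theorem reaches_lookup {k1 p s sb v tp e a r8 r9 r10 r11 kb x h k2 sz off y key : ℕ}
    (hZ : 1000 ≤ Z) (hZB : Z * Z ≤ B) (hMZ : M ≤ Z) (hv : v + 3 < M) (h3 : f (v + 3) = kb)
    (hx : kb + a = x) (hh : x * k1 % p % s = h) (hhM : h * 20 + 20 ≤ M)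
    (hk2 : f (h * 20 + 10) = k2) (hsz : f (h * 20 + 11) = sz) (hoff : f (h * 20 + 12) = off)
    (hy : x * k2 % p % sz * 20 + off = y) (hyM : y + 20 ≤ M) (hkey : f (y + 13) = key)
    (hk1Z : k1 < Z) (hp : 0 < p) (hpZ : p < Z)
    (hxZ : x < Z) (hk2Z : k2 < Z) (hszZ : sz < Z) (hkeyZ : key < Z)
    (H : ∀ r9, Reaches B prog Q t (state M 42
      [k1, p, s, sb, v, tp, e, a, x, r9, y, key, 0, 0, 0, 0, 0, 0, 0, 0, 0] f inp out)) :
    Reaches B prog Q (t + 27) (state M 15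
      [k1, p, s, sb, v, tp, e, a, r8, r9, r10, r11, 0, 0, 0, 0, 0, 0, 0, 0, 0] f inp out) := by
  refine Reaches.block lookupCode 27 rfl rfl ?_
  have hZB' : 1000 * Z ≤ B := (Nat.mul_le_mul_right Z hZ).trans hZB
  simp only [lookupCode, wp, BinOp.eval, List.set_cons_succ, List.set_cons_zero,
    List.getD_cons_succ, List.getD_cons_zero, List.length_cons, List.length_nil,
    Nat.reduceAdd, Nat.reduceLT, true_and, h3, hx, hh, hk2, hsz, hoff, hy, hkey]
  have m1 : x * k1 < B := (Nat.mul_lt_mul'' hxZ hk1Z).trans_le hZB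
  have m2 : x * k2 < B := (Nat.mul_lt_mul'' hxZ hk2Z).trans_le hZB
  have m3 : x * k1 % p < p := Nat.mod_lt _ hp
  have m4 : x * k2 % p < p := Nat.mod_lt _ hp
  have m5 : x * k2 % p % sz ≤ x * k2 % p := Nat.mod_le _ _
  refine ⟨?_, ?_, ?_, ?_, ?_, ?_, ?_, ?_, ?_, ?_, ?_, ?_, ?_, ?_, ?_, ?_, ?_, ?_, ?_, ?_, ?_, ?_, ?_,
    ?_, ?_, ?_, ?_, ?_, ?_, ?_, ?_, ?_, H _⟩
  all_goals first | assumption | omega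

theorem reaches_child {k1 p s sb v tp e a x y r9 r11 v' tp' e' : ℕ}
    (hZB : Z * Z ≤ B) (hZ : 1000 ≤ Z) (hMZ : M ≤ Z) (hy : y + 20 ≤ M) (h14 : f (y + 14) = v')
    (h15 : f (y + 15) = tp') (hv' : v' + 20 ≤ M) (h2 : f (v' + 2) = e')
    (htp' : tp' < Z) (he' : e' < Z)
    (H : Reaches B prog Q t (state M 13
      [k1, p, s, sb, v', tp', e', a, x, r9, y, r11, 0, 0, 0, 0, 0, 0, 0, 0, 0] f inp out)) :
    Reaches B prog Q (t + 10) (state M 44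
      [k1, p, s, sb, v, tp, e, a, x, r9, y, r11, 0, 0, 0, 0, 0, 0, 0, 0, 0] f inp out) := by
  refine Reaches.block (t := t + 1) childCode 9 rfl rfl ?_
  have hZB' : 1000 * Z ≤ B := (Nat.mul_le_mul_right Z hZ).trans hZB
  simp only [childCode, wp, BinOp.eval, List.set_cons_succ, List.set_cons_zero,
    List.getD_cons_succ, List.getD_cons_zero, List.length_cons, List.length_nil,
    Nat.reduceAdd, Nat.reduceLT, true_and, h14, h15, h2]
  refine ⟨?_, ?_, ?_, ?_, ?_, ?_, ?_, ?_, ?_, ?_, ?_, ?_, Reaches.jump rfl H⟩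
  all_goals omega

theorem reaches_edge {k1 p s sb v tp e a r8 r9 r10 r11 b : ℕ}
    (hZB : Z * Z ≤ B) (hZ : 1000 ≤ Z) (hMZ : M ≤ Z) (htp : tp + 20 ≤ M) (hb : f tp = b) (hbZ : b < Z)
    (H : ∀ r9, Reaches B prog Q t (state M (if a < b then 163 else if b < a then 163 else 13)
      [k1, p, s, sb, v, tp + 20, e, a, b, r9, r10, r11, 0, 0, 0, 0, 0, 0, 0, 0, 0] f inp out)) :
    Reaches B prog Q (t + 6) (state M 54
      [k1, p, s, sb, v, tp, e, a, r8, r9, r10, r11, 0, 0, 0, 0, 0, 0, 0, 0, 0] f inp out) := by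
  refine Reaches.block (t := t + 3) edgeCode 3 rfl rfl ?_
  have hZB' : 1000 * Z ≤ B := (Nat.mul_le_mul_right Z hZ).trans hZB
  simp only [edgeCode, wp, BinOp.eval, List.set_cons_succ, List.set_cons_zero,
    List.getD_cons_succ, List.getD_cons_zero, List.length_cons, List.length_nil,
    Nat.reduceAdd, Nat.reduceLT, true_and, hb]
  refine ⟨by omega, by omega, by omega, by omega, ?_⟩
  refine Reaches.jlt rfl ?_
  simp only [List.getD_cons_succ, List.getD_cons_zero]
  have H := H 20
  by_cases h1 : a < b
  · rw [if_pos h1] at H ⊢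
    exact H.mono (by omega)
  · rw [if_neg h1] at H ⊢
    refine Reaches.jlt rfl ?_
    simp only [List.getD_cons_succ, List.getD_cons_zero]
    by_cases h2 : b < a
    · rw [if_pos h2] at H ⊢
      exact H.mono (by omega)
    · rw [if_neg h2] at H ⊢
      exact Reaches.jump rfl H

variable {σ S : ℕ} {T : List (Fin σ)} {F : ℕ → ℕ → ℕ} {id : Finset ℕ → ℕ}

/-- The least position of a set, chosen as its representative occurrence. -/
noncomputable def start (A : Finset ℕ) : ℕ := sInf (A : Set ℕ)

theorem start_mem {A : Finset ℕ} (hA : A ∈ nodes T) : start A ∈ A := by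
  have h : ((A : Set ℕ)).Nonempty := (mem_nodes.1 hA).1
  exact Nat.sInf_mem h

/-- The arrays `F 0`, `F 2`, `F 3` and `F 10, …, F 15` with the parameters `F 18` store the text
and a suffix tree whose children are found by perfect hashing.  Array `i` has its entry `x` at the
address `20 * x + i`, pointers are stored as `20 * x`, and `id A` is the index of the node `A`. -/
structure IsTree (T : List (Fin σ)) (S Z : ℕ) (F : ℕ → ℕ → ℕ) (id : Finset ℕ → ℕ) : Prop where
  lt : ∀ i x, F i x < Z
  id_lt : ∀ A ∈ nodes T, id A < S
  text : ∀ (i : ℕ) (a : Fin σ), T[i]? = some a → i < S ∧ F 0 i = (a : ℕ)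
  last : ∀ A ∈ nodes T, F 2 (id A) = 20 * (start A + (label T A).length)
  mod_pos : 0 < F 18 1
  key_lt : ∀ A ∈ nodes T, ∀ a : Fin σ, F 3 (id A) + a < Z
  bucket_lt : ∀ x, x * F 18 0 % F 18 1 % F 18 2 < S
  child : ∀ A ∈ nodes T, ∀ a : Fin σ, ∀ x h, x = F 3 (id A) + a →
    h = x * F 18 0 % F 18 1 % F 18 2 →
    ∃ y < S, x * F 10 h % F 18 1 % F 11 h * 20 + F 12 h = 20 * y ∧
      ((occurrences (label T A ++ [a]) T).Nonempty → F 13 y = x ∧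
        F 14 y = 20 * id (occurrences (label T A ++ [a]) T) ∧
        F 15 y = 20 * (start (occurrences (label T A ++ [a]) T) + ((label T A).length + 1))) ∧
      (¬ (occurrences (label T A ++ [a]) T).Nonempty → F 13 y ≠ x)

/-- The loop over the pattern.  When `w` has been read, the machine is at the node `A` of all
occurrences of `w`, and the text pointer is behind the representative occurrence of `w`. -/
theorem reaches_match (hT : IsTree T S Z F id) (hZB : Z * Z ≤ B) (hZ : 1000 ≤ Z) (hMZ : M ≤ Z)
    (hSM : 20 * S ≤ M) (hσ : σ ≤ Z)
    (hf : ∀ x < S, ∀ i < 20, f (20 * x + i) = F i x) (sb : ℕ) (P : List (Fin σ)) :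
    ∀ (w : List (Fin σ)) (A : Finset ℕ), A ∈ nodes T → occurrences w T = A →
      (occurrences (w ++ P) T = ∅ → ∀ L inp, Q (state M 163 L f inp out)) →
      (∀ A ∈ nodes T, occurrences (w ++ P) T = A → ∀ tp e r7 r8 r9 r10 r11,
        Reaches B prog Q t (state M 60
          [F 18 0, F 18 1, F 18 2, sb, 20 * id A, tp, e, r7, r8, r9, r10, r11,
            0, 0, 0, 0, 0, 0, 0, 0, 0] f [] out)) →
      ∀ r7 r8 r9 r10 r11, Reaches B prog Q (t + 1 + 50 * P.length) (state M 13
        [F 18 0, F 18 1, F 18 2, sb, 20 * id A, 20 * (start A + w.length),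
          20 * (start A + (label T A).length), r7, r8, r9, r10, r11,
          0, 0, 0, 0, 0, 0, 0, 0, 0] f (P.map Fin.val) out) := by
  have hZB' : 1000 * Z ≤ B := (Nat.mul_le_mul_right Z hZ).trans hZB
  induction P with
  | nil =>
    intro w A hA hw _ H r7 r8 r9 r10 r11
    refine Reaches.read_nil rfl ?_
    rw [List.append_nil] at H
    exact H A hA hw _ _ _ _ _ _ _
  | cons a P ih =>
    intro w A hA hw hfail H r7 r8 r9 r10 r11
    have ha := a.2
    rw [List.append_cons] at hfail H
    have hempty : occurrences (w ++ [a]) T = ∅ → occurrences (w ++ [a] ++ P) T = ∅ := fun h =>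
      Finset.subset_empty.1 (h ▸ occurrences_anti (List.prefix_append _ _))
    rw [show t + 1 + 50 * (a :: P).length = t + 1 + 50 * P.length + 48 + 1 + 1 by simp; ring]
    rw [List.map_cons]
    refine Reaches.read_cons rfl (by simp) (by omega) (Reaches.jlt rfl ?_)
    simp only [List.set_cons_succ, List.set_cons_zero, List.getD_cons_succ, List.getD_cons_zero]
    split_ifs with hlt
    · -- inside an edge
      have hlt' : w.length < (label T A).length := by omega
      have hsA := start_mem hA
      have hb : start A + w.length < T.length := by
        have := length_add_le_of_mem_occurrences (T := T) (P := label T A) (i := start A)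
          (by rw [occurrences_label hA]; exact hsA)
        omega
      obtain ⟨b, hb'⟩ : ∃ b, T[start A + w.length]? = some b := ⟨_, List.getElem?_eq_getElem hb⟩
      have hocc := occurrences_snoc_of_lt hA hw hlt' hsA a
      obtain ⟨hiS, h0⟩ := hT.text _ _ hb'
      rw [hb'] at hocc
      refine (reaches_edge (t := t + 1 + 50 * P.length) hZB hZ hMZ (b := b) (by omega) ?_ ?_ ?_).mono
        (by omega)
      · rw [← h0, ← hf _ hiS 0 (by norm_num)]; rfl
      · rw [← h0]; exact hT.lt _ _
      intro r9
      by_cases hab : b = a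
      · subst hab
        rw [if_pos rfl] at hocc
        simp only [lt_irrefl, if_false]
        have := ih (w ++ [b]) A hA hocc hfail H b b r9 r10 r11
        rw [List.length_append] at this
        exact this
      · have hne : occurrences (w ++ [a]) T = ∅ := by
          rw [if_neg (by simpa using hab)] at hocc; exact hocc
        have hv : (b : ℕ) ≠ a := fun h => hab (Fin.ext h)
        have : (if (a : ℕ) < b then 163 else if (b : ℕ) < a then 163 else 13) = 163 := by
          split_ifs <;> omega
        rw [this]
        exact Reaches.refl (hfail (hempty hne) _ _)
    · -- at a node
      have hwl : w = label T A := by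
        refine (prefix_label hA hw).eq_of_length_le ?_
        omega
      obtain ⟨y, hyS, hy, hpos, hneg⟩ := hT.child A hA a _ _ rfl rfl
      have hid := hT.id_lt A hA
      have hhS := hT.bucket_lt (F 3 (id A) + a)
      refine (reaches_lookup (t := t + 1 + 50 * P.length + 12) hZ hZB hMZ (by omega)
        (hf _ hid 3 (by norm_num)) rfl rfl (by omega)
        (by rw [mul_comm]; exact hf _ hhS 10 (by norm_num))
        (by rw [mul_comm]; exact hf _ hhS 11 (by norm_num))
        (by rw [mul_comm]; exact hf _ hhS 12 (by norm_num)) hy (by omega)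
        (hf _ hyS 13 (by norm_num)) (hT.lt _ _) hT.mod_pos (hT.lt _ _)
        (hT.key_lt A hA a) (hT.lt _ _) (hT.lt _ _) (hT.lt _ _) ?_).mono (by omega)
      intro r9
      have hocc : occurrences (w ++ [a]) T = occurrences (label T A ++ [a]) T := by rw [hwl]
      by_cases hex : (occurrences (label T A ++ [a]) T).Nonempty
      · obtain ⟨h13, h14, h15⟩ := hpos hex
        rw [h13]
        refine Reaches.jlt rfl ?_
        simp only [List.getD_cons_succ, List.getD_cons_zero, lt_irrefl, if_false]
        refine Reaches.jlt rfl ?_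
        simp only [List.getD_cons_succ, List.getD_cons_zero, lt_irrefl, if_false]
        have hA' : occurrences (label T A ++ [a]) T ∈ nodes T := mem_nodes.2 ⟨hex, _, rfl⟩
        have hid' := hT.id_lt _ hA'
        refine reaches_child hZB hZ hMZ (by omega) ((hf _ hyS 14 (by norm_num)).trans h14)
          ((hf _ hyS 15 (by norm_num)).trans h15) (by omega) (hf _ hid' 2 (by norm_num)) ?_
          (hT.lt _ _) ?_
        · rw [← h15]; exact hT.lt _ _
        · rw [hT.last _ hA']
          have := ih (w ++ [a]) _ hA' hocc hfail H a (F 3 (id A) + a) r9 (20 * y) (F 3 (id A) + a)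
          rw [List.length_append, hwl] at this
          exact this
      · have hne := hneg hex
        have hfail := hfail (hempty (hocc.trans (Finset.not_nonempty_iff_eq_empty.1 hex)))
        refine Reaches.jlt rfl ?_
        simp only [List.getD_cons_succ, List.getD_cons_zero]
        split_ifs with h1
        · exact Reaches.refl (hfail _ _)
        · refine Reaches.jlt rfl ?_
          simp only [List.getD_cons_succ, List.getD_cons_zero]
          rw [if_pos (by omega)]
          exact Reaches.refl (hfail _ _)

end Matching

end SortedReporting

/-! ### Two-pass radix sort -/

namespace SortedReporting

section RadixSort

variable {k K : ℕ} {lo hi val : ℕ → ℕ}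

/-- The bucket of the low digit `b` after the items below `k` have been pushed. -/
def lowBucket (lo : ℕ → ℕ) (k b : ℕ) : List ℕ := (List.range k).reverse.filter (lo · = b)

theorem lowBucket_succ (t b : ℕ) :
    lowBucket lo (t + 1) b = if lo t = b then t :: lowBucket lo t b else lowBucket lo t b := by
  simp [lowBucket, List.range_succ, List.filter_cons]

theorem mem_lowBucket {b i : ℕ} : i ∈ lowBucket lo k b ↔ i < k ∧ lo i = b := by
  simp [lowBucket]

/-- The items in the order in which the second pass meets them. -/
def lowItems (lo : ℕ → ℕ) (k b : ℕ) : List ℕ := (List.range b).reverse.flatMap (lowBucket lo k)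

theorem lowItems_succ (b : ℕ) :
    lowItems lo k (b + 1) = lowBucket lo k b ++ lowItems lo k b := by
  simp [lowItems, List.range_succ]

theorem mem_lowItems {b i : ℕ} : i ∈ lowItems lo k b ↔ i < k ∧ lo i < b := by
  simp [lowItems, mem_lowBucket]
  tauto

theorem pairwise_lowItems (b : ℕ) :
    (lowItems lo k b).Pairwise fun x y => lo y ≤ lo x ∧ x ≠ y := by
  rw [lowItems, List.pairwise_flatMap]
  constructor
  · intro b _
    have hnd : (lowBucket lo k b).Nodup := (List.nodup_reverse.2 List.nodup_range).filter _
    refine List.Pairwise.imp_of_mem ?_ hnd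
    intro x y hx hy hne
    exact ⟨((mem_lowBucket.1 hy).2.trans (mem_lowBucket.1 hx).2.symm).le, hne⟩
  · rw [List.pairwise_reverse]
    refine List.Pairwise.imp ?_ List.pairwise_lt_range
    intro c d hcd x hx y hy
    have h1 := (mem_lowBucket.1 hx).2
    have h2 := (mem_lowBucket.1 hy).2
    refine ⟨by omega, ?_⟩
    rintro rfl
    omega

theorem nodup_lowItems (b : ℕ) : (lowItems lo k b).Nodup :=
  (pairwise_lowItems b).imp fun h => h.2

/-- The bucket of the high digit `h` after the second pass has met the items of `R`, the last one
first. -/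
def highBucket (hi : ℕ → ℕ) (R : List ℕ) (h : ℕ) : List ℕ := R.filter (hi · = h)

/-- The buckets of the high digits, one after the other, list the items in increasing order. -/
theorem map_highBucket_eq_sort (hlo : ∀ i < k, lo i < K) (hhi : ∀ i < k, hi i < K)
    (hlt : ∀ i < k, ∀ j < k, val i < val j → hi i < hi j ∨ hi i = hi j ∧ lo i < lo j)
    (hinj : ∀ i < k, ∀ j < k, val i = val j → i = j) :
    ((List.range K).flatMap (highBucket hi (lowItems lo k K).reverse)).map val =
      ((Finset.range k).image val).sort (· ≤ ·) := by
  set O := (List.range K).flatMap (highBucket hi (lowItems lo k K).reverse) with hO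
  have hmem : ∀ i, i ∈ O ↔ i < k := by
    intro i
    simp only [hO, highBucket, List.mem_flatMap, List.mem_range, List.mem_filter,
      List.mem_reverse, mem_lowItems, decide_eq_true_eq]
    constructor
    · rintro ⟨h, -, h1, -⟩; exact h1.1
    · intro h; exact ⟨hi i, hhi i h, ⟨h, hlo i h⟩, rfl⟩
  have hpw : O.Pairwise fun x y => val x < val y := by
    rw [hO, List.pairwise_flatMap]
    constructor
    · intro h _
      refine List.Pairwise.imp_of_mem (R := fun x y => lo x ≤ lo y ∧ x ≠ y) ?_ ?_
      · intro x y hx hy hxy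
        simp only [highBucket, List.mem_filter, List.mem_reverse, mem_lowItems,
          decide_eq_true_eq] at hx hy
        rcases lt_trichotomy (val x) (val y) with h1 | h1 | h1
        · exact h1
        · exact absurd (hinj x hx.1.1 y hy.1.1 h1) hxy.2
        · have := hlt y hy.1.1 x hx.1.1 h1
          omega
      · refine List.Pairwise.filter _ (List.pairwise_reverse.2 ?_)
        exact (pairwise_lowItems K).imp fun h => ⟨h.1, h.2.symm⟩
    · refine List.Pairwise.imp ?_ List.pairwise_lt_range
      intro c d hcd x hx y hy
      simp only [highBucket, List.mem_filter, List.mem_reverse, mem_lowItems,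
        decide_eq_true_eq] at hx hy
      rcases lt_trichotomy (val x) (val y) with h1 | h1 | h1
      · exact h1
      · have := hinj x hx.1.1 y hy.1.1 h1
        subst this; omega
      · have := hlt y hy.1.1 x hx.1.1 h1
        omega
  have hpw' : (O.map val).Pairwise (· < ·) := List.pairwise_map.2 hpw
  refine List.Perm.eq_of_pairwise' (r := (· ≤ ·)) (hpw'.imp le_of_lt) (Finset.pairwise_sort _ _) ?_
  rw [List.perm_ext_iff_of_nodup (hpw'.imp ne_of_lt) (Finset.sort_nodup _ _)]
  intro x
  simp [hmem]

end RadixSort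

/-! ### Linked lists in the scratch memory -/

section Chains

variable {sb c x : ℕ} {f f' : ℕ → ℕ} {L : List ℕ}

/-- The pointer `x` is the head of a linked list of the items `L`.  Item `i` has the eight cells
from `sb + 8 * i` on, of which cell `c` holds the next pointer; `0` is the null pointer. -/
def Chain (sb c : ℕ) (f : ℕ → ℕ) : ℕ → List ℕ → Prop
  | x, [] => x = 0
  | x, i :: L => x = sb + 8 * i ∧ Chain sb c f (f (sb + 8 * i + c)) L

theorem Chain.congr (h : Chain sb c f x L)
    (hf : ∀ i ∈ L, f' (sb + 8 * i + c) = f (sb + 8 * i + c)) : Chain sb c f' x L := by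
  induction L generalizing x with
  | nil => exact h
  | cons i L ih =>
    refine ⟨h.1, ?_⟩
    rw [hf i (by simp)]
    exact ih h.2 fun j hj => hf j (by simp [hj])

theorem Chain.lt (h : Chain sb c f x L) {k M : ℕ} (hL : ∀ i ∈ L, i < k) (hM : sb + 8 * k < M) :
    x < M := by
  cases L with
  | nil => obtain rfl : x = 0 := h; omega
  | cons i L =>
    have := hL i (by simp)
    have := h.1
    omega

end Chains

end SortedReporting

/-! ### Reporting a node -/

namespace SortedReporting

section Report

variable {B M Z t : ℕ} {Q : Config → Prop} {g f : ℕ → ℕ} {inp out : List ℕ}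
  {c0 c1 c2 sb v c5 k K l q ka ta : ℕ} {lo hi val : ℕ → ℕ}

theorem reaches_record {c6 c7 c8 c9 c10 c11 : ℕ} (hZB : Z * Z ≤ B) (hZ : 1000 ≤ Z) (hMZ : M ≤ Z)
    (hv : v + 20 ≤ M) (hK : sb + 8 * K ≤ M) (h4 : f (v + 4) = l) (h6 : f (v + 6) = K)
    (h7 : f (v + 7) = q) (h8 : f (v + 8) = ka) (h9 : f (v + 9) = ta)
    (hl : l < Z) (hq : q < Z) (hka : ka < Z) (hta : ta < Z)
    (H : Reaches B prog Q t (state M 79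
      [c0, c1, c2, sb, v, c5, c6, c7, c8, c9, c10, c11, l, K, q, ka, ta, sb, sb + 8 * K, 8, 0]
        f inp out)) :
    Reaches B prog Q (t + 19) (state M 60
      [c0, c1, c2, sb, v, c5, c6, c7, c8, c9, c10, c11, 0, 0, 0, 0, 0, 0, 0, 0, 0] f inp out) := by
  refine Reaches.block recordCode 19 rfl rfl ?_
  have hZB' : 1000 * Z ≤ B := (Nat.mul_le_mul_right Z hZ).trans hZB
  have e : K * 8 + sb = sb + 8 * K := by ring
  simp only [recordCode, wp, BinOp.eval, List.set_cons_succ, List.set_cons_zero,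
    List.getD_cons_succ, List.getD_cons_zero, List.length_cons, List.length_nil,
    Nat.reduceAdd, Nat.reduceLT, true_and, h4, h6, h7, h8, h9, e, Nat.add_zero]
  refine ⟨?_, ?_, ?_, ?_, ?_, ?_, ?_, ?_, ?_, ?_, ?_, ?_, ?_, ?_, ?_, ?_, ?_, ?_, ?_, ?_, ?_, ?_, ?_,
    ?_, H⟩
  all_goals omega

theorem reaches_clear {c6 c7 c8 c9 c10 : ℕ} (hZB : Z * Z ≤ B) (hZ : 1000 ≤ Z) (hMZ : M ≤ Z)
    (hK : sb + 8 * K + 8 ≤ M)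
    (H : ∀ f, (∀ a < sb, f a = g a) → (∀ b < K, f (sb + 8 * b) = 0 ∧ f (sb + 8 * b + 1) = 0) →
      ∀ c11, Reaches B prog Q t (state M 88 [c0, c1, c2, sb, v, c5, c6, c7, c8, c9, c10, c11,
        l, K, q, ka, ta, sb + 8 * K, sb + 8 * K, 8, 0] f inp out)) :
    ∀ j b f, b + j = K → (∀ a < sb, f a = g a) →
      (∀ i < b, f (sb + 8 * i) = 0 ∧ f (sb + 8 * i + 1) = 0) → ∀ c11,
      Reaches B prog Q (t + 2 + 8 * j) (state M 79 [c0, c1, c2, sb, v, c5, c6, c7, c8, c9, c10, c11,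
        l, K, q, ka, ta, sb + 8 * b, sb + 8 * K, 8, 0] f inp out) := by
  have hZB' : 1000 * Z ≤ B := (Nat.mul_le_mul_right Z hZ).trans hZB
  intro j
  induction j with
  | zero =>
    intro b f hb hf h0 c11
    obtain rfl : b = K := by omega
    refine Reaches.jlt (t := t + 1) rfl ?_
    simp only [List.getD_cons_succ, List.getD_cons_zero, lt_irrefl, if_false]
    exact Reaches.jump rfl (H f hf h0 c11)
  | succ j ih =>
    intro b f hb hf h0 c11
    refine Reaches.jlt (t := t + 2 + 8 * j + 7) rfl ?_
    simp only [List.getD_cons_succ, List.getD_cons_zero]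
    rw [if_pos (by omega)]
    refine Reaches.block (t := t + 2 + 8 * j + 1) clearCode 6 rfl rfl ?_
    simp only [clearCode, wp, BinOp.eval, List.set_cons_succ, List.set_cons_zero,
      List.getD_cons_succ, List.getD_cons_zero, List.length_cons, List.length_nil,
      Nat.reduceAdd, Nat.reduceLT, true_and]
    refine ⟨by omega, by omega, by omega, by omega, by omega, by omega, Reaches.jump rfl ?_⟩
    have e : sb + 8 * b + 8 = sb + 8 * (b + 1) := by ring
    rw [e]
    refine ih (b + 1) _ (by omega) ?_ ?_ _
    · intro a ha
      rw [Function.update_of_ne (by omega), Function.update_of_ne (by omega), hf a ha]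
    · intro i hi
      simp only [Function.update_apply]
      constructor
      · split_ifs with h1 h2
        · rfl
        · rfl
        · exact (h0 i (by omega)).1
      · split_ifs with h1 h2
        · rfl
        · rfl
        · exact (h0 i (by omega)).2

theorem reaches_count {c6 c7 c8 c9 c10 c11 c17 c18 : ℕ} (hZB : Z * Z ≤ B) (hZ : 1000 ≤ Z)
    (hMZ : M ≤ Z) (hv : v + 20 ≤ M) (hk : sb + 8 * k ≤ M) (h5 : f (v + 5) = k)
    (H : ∀ c8, Reaches B prog Q t (state M 95
      [c0, c1, c2, sb, v, c5, sb + 8 * k, c7, c8, c9, c10, c11, l, K, q, ka, ta, sb, c18, 8, 0]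
        f inp out)) :
    Reaches B prog Q (t + 7) (state M 88
      [c0, c1, c2, sb, v, c5, c6, c7, c8, c9, c10, c11, l, K, q, ka, ta, c17, c18, 8, 0]
        f inp out) := by
  refine Reaches.block countCode 7 rfl rfl ?_
  have hZB' : 1000 * Z ≤ B := (Nat.mul_le_mul_right Z hZ).trans hZB
  have e : k * 8 + sb = sb + 8 * k := by ring
  simp only [countCode, wp, BinOp.eval, List.set_cons_succ, List.set_cons_zero,
    List.getD_cons_succ, List.getD_cons_zero, List.length_cons, List.length_nil,
    Nat.reduceAdd, Nat.reduceLT, true_and, h5, e, Nat.add_zero]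
  refine ⟨?_, ?_, ?_, ?_, ?_, ?_, ?_, ?_, H _⟩
  all_goals omega

theorem reaches_digits {c6 c7 c8 c9 c10 c11 c17 c18 c19 p aw ap d e : ℕ} (hZB : Z * Z ≤ B)
    (hZ : 1000 ≤ Z) (hMZ : M ≤ Z) (hp : p < Z) (haw : p / q * 20 + ka = aw) (hawM : aw < M)
    (hap : p % q * 20 + ta = ap) (hapM : ap < M) (hw : f aw < Z) (hu : f ap < Z)
    (hd : f aw / f ap % K = d) (he : f aw / f ap / K % K = e)
    (H : Reaches B prog Q t (state M 110
      [c0, c1, c2, sb, v, c5, c6, c7, e, 20, d, c11, p, K, q, ka, ta, c17, c18, c19, 0]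
        f inp out)) :
    Reaches B prog Q (t + 13) (state M 97
      [c0, c1, c2, sb, v, c5, c6, c7, c8, c9, c10, c11, p, K, q, ka, ta, c17, c18, c19, 0]
        f inp out) := by
  refine Reaches.block digitsCode 13 rfl rfl ?_
  have hZB' : 1000 * Z ≤ B := (Nat.mul_le_mul_right Z hZ).trans hZB
  have b1 : p / q ≤ p := Nat.div_le_self _ _
  have b2 : p % q ≤ p := Nat.mod_le _ _
  have b3 : f aw / f ap ≤ f aw := Nat.div_le_self _ _
  have b4 : f aw / f ap % K ≤ f aw / f ap := Nat.mod_le _ _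
  have b5 : f aw / f ap / K ≤ f aw / f ap := Nat.div_le_self _ _
  have b6 : f aw / f ap / K % K ≤ f aw / f ap / K := Nat.mod_le _ _
  rw [hd] at b4
  rw [he] at b6
  simp only [digitsCode, wp, BinOp.eval, List.set_cons_succ, List.set_cons_zero,
    List.getD_cons_succ, List.getD_cons_zero, List.length_cons, List.length_nil,
    Nat.reduceAdd, Nat.reduceLT, true_and, haw, hap, hd, he]
  refine ⟨?_, ?_, ?_, ?_, ?_, ?_, ?_, ?_, ?_, ?_, ?_, ?_, ?_, ?_, ?_, H⟩
  all_goals omega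

theorem reaches_push_low {c6 c7 c11 c18 c19 p i d e w : ℕ} (hZB : Z * Z ≤ B)
    (hZ : 1000 ≤ Z) (hMZ : M ≤ Z) (hd : d < K) (he : e < K) (hK : sb + 8 * K + 8 ≤ M)
    (hi : sb + 8 * i + 8 ≤ M) (hp : p * 20 + 1 < sb) (hw : f (p * 20 + 1) = w) (hwZ : w < Z)
    (hold : f (sb + 8 * d) < M)
    (H : ∀ c8 c10 c11, Reaches B prog Q t (state M 95
      [c0, c1, c2, sb, v, c5, c6, c7, c8, 20, c10, c11, p + 1, K, q, ka, ta,
        sb + 8 * (i + 1), c18, c19, 0]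
      (Function.update (Function.update (Function.update (Function.update f
        (sb + 8 * i + 4) (sb + 8 * e)) (sb + 8 * d) (sb + 8 * i)) (sb + 8 * i + 2) (f (sb + 8 * d)))
        (sb + 8 * i + 5) w) inp out)) :
    Reaches B prog Q (t + 25) (state M 110
      [c0, c1, c2, sb, v, c5, c6, c7, e, 20, d, c11, p, K, q, ka, ta, sb + 8 * i, c18, c19, 0]
        f inp out) := by
  refine Reaches.block (t := t + 1) lowCode 24 rfl rfl ?_
  have hZB' : 1000 * Z ≤ B := (Nat.mul_le_mul_right Z hZ).trans hZB
  have ee : e * 8 + sb = sb + 8 * e := by ring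
  have ed : d * 8 + sb = sb + 8 * d := by ring
  have ei : sb + 8 * i + 8 = sb + 8 * (i + 1) := by ring
  have u1 : ∀ x, Function.update f (sb + 8 * i + 4) x (sb + 8 * d) = f (sb + 8 * d) :=
    fun x => Function.update_of_ne (by omega) _ _
  have u2 : ∀ x y z, Function.update (Function.update (Function.update f (sb + 8 * i + 4) x)
      (sb + 8 * d) y) (sb + 8 * i + 2) z (p * 20 + 1) = w := fun x y z => by
    rw [Function.update_of_ne (by omega), Function.update_of_ne (by omega),
      Function.update_of_ne (by omega), hw]
  simp only [lowCode, wp, BinOp.eval, List.set_cons_succ, List.set_cons_zero,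
    List.getD_cons_succ, List.getD_cons_zero, List.length_cons, List.length_nil,
    Nat.reduceAdd, Nat.reduceLT, true_and, ee, ed, ei, u1, u2]
  refine ⟨?_, ?_, ?_, ?_, ?_, ?_, ?_, ?_, ?_, ?_, ?_, ?_, ?_, ?_, ?_, ?_, ?_, ?_, ?_, ?_, ?_, ?_,
    ?_, ?_, ?_, ?_, Reaches.jump rfl (H _ _ _)⟩
  all_goals omega

/-- The first pass, after `i` items: they have been pushed to the buckets of their low digits, and
the buckets of the high digits are empty. -/
structure LowInv (g : ℕ → ℕ) (sb K : ℕ) (lo hi val : ℕ → ℕ) (i : ℕ) (f : ℕ → ℕ) : Prop where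
  frame : ∀ a < sb, f a = g a
  high : ∀ b < K, f (sb + 8 * b + 1) = 0
  low : ∀ b < K, Chain sb 2 f (f (sb + 8 * b)) (lowBucket lo i b)
  item : ∀ j < i, f (sb + 8 * j + 4) = sb + 8 * hi j ∧ f (sb + 8 * j + 5) = val j

theorem LowInv.push {i : ℕ} (h : LowInv g sb K lo hi val i f) :
    LowInv g sb K lo hi val (i + 1)
      (Function.update (Function.update (Function.update (Function.update f
        (sb + 8 * i + 4) (sb + 8 * hi i)) (sb + 8 * lo i) (sb + 8 * i)) (sb + 8 * i + 2)
        (f (sb + 8 * lo i))) (sb + 8 * i + 5) (val i)) := by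
  set f' := Function.update (Function.update (Function.update (Function.update f
        (sb + 8 * i + 4) (sb + 8 * hi i)) (sb + 8 * lo i) (sb + 8 * i)) (sb + 8 * i + 2)
        (f (sb + 8 * lo i))) (sb + 8 * i + 5) (val i) with hf'
  have hne : ∀ a, a ≠ sb + 8 * i + 4 → a ≠ sb + 8 * lo i → a ≠ sb + 8 * i + 2 →
      a ≠ sb + 8 * i + 5 → f' a = f a := fun a h1 h2 h3 h4 => by
    rw [hf', Function.update_of_ne h4, Function.update_of_ne h3, Function.update_of_ne h2,
      Function.update_of_ne h1]
  have e5 : f' (sb + 8 * i + 5) = val i := Function.update_self _ _ _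
  have e2 : f' (sb + 8 * i + 2) = f (sb + 8 * lo i) := by
    rw [hf', Function.update_of_ne (by omega), Function.update_self]
  have e0 : f' (sb + 8 * lo i) = sb + 8 * i := by
    rw [hf', Function.update_of_ne (by omega), Function.update_of_ne (by omega),
      Function.update_self]
  have e4 : f' (sb + 8 * i + 4) = sb + 8 * hi i := by
    rw [hf', Function.update_of_ne (by omega), Function.update_of_ne (by omega),
      Function.update_of_ne (by omega), Function.update_self]
  have hch : ∀ b, ∀ x, Chain sb 2 f x (lowBucket lo i b) → Chain sb 2 f' x (lowBucket lo i b) := by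
    intro b x hx
    refine hx.congr fun j hj => ?_
    have := (mem_lowBucket.1 hj).1
    exact hne _ (by omega) (by omega) (by omega) (by omega)
  refine ⟨fun a ha => ?_, fun b hb => ?_, fun b hb => ?_, fun j hj => ?_⟩
  · rw [hne a (by omega) (by omega) (by omega) (by omega), h.frame a ha]
  · rw [hne _ (by omega) (by omega) (by omega) (by omega), h.high b hb]
  · rw [lowBucket_succ]
    split_ifs with hlb
    · subst hlb
      rw [e0]
      refine ⟨rfl, ?_⟩
      rw [e2]
      exact hch _ _ (h.low _ hb)
    · rw [hne _ (by omega) (by omega) (by omega) (by omega)]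
      exact hch _ _ (h.low _ hb)
  · rcases Nat.lt_succ_iff_lt_or_eq.1 hj with hj | rfl
    · rw [hne _ (by omega) (by omega) (by omega) (by omega),
        hne _ (by omega) (by omega) (by omega) (by omega)]
      exact h.item j hj
    · exact ⟨e4, e5⟩

/-- The items of a node, `k` entries of the suffix array from `l` on: their values are `val`, and
the digits of their keys, found by means of `q`, `ka` and `ta` in the packed tables, are `lo` and
`hi`. -/
structure IsItems (g : ℕ → ℕ) (M Z sb k K l q ka ta : ℕ) (lo hi val : ℕ → ℕ) : Prop where
  val_eq : ∀ i < k, (l + i) * 20 + 1 < sb ∧ g ((l + i) * 20 + 1) = val i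
  word : ∀ i < k, (l + i) / q * 20 + ka < sb ∧ (l + i) % q * 20 + ta < sb
  low : ∀ i < k, g ((l + i) / q * 20 + ka) / g ((l + i) % q * 20 + ta) % K = lo i
  high : ∀ i < k, g ((l + i) / q * 20 + ka) / g ((l + i) % q * 20 + ta) / K % K = hi i
  lt : ∀ a < sb, g a < Z
  pos : 0 < K
  mem_le : sb + 8 * k + 8 ≤ M
  mem_le' : sb + 8 * K + 8 ≤ M

theorem IsItems.low_lt (hI : IsItems g M Z sb k K l q ka ta lo hi val) : ∀ i < k, lo i < K :=
  fun i h => by rw [← hI.low i h]; exact Nat.mod_lt _ hI.pos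

theorem IsItems.high_lt (hI : IsItems g M Z sb k K l q ka ta lo hi val) : ∀ i < k, hi i < K :=
  fun i h => by rw [← hI.high i h]; exact Nat.mod_lt _ hI.pos

theorem IsItems.val_lt (hI : IsItems g M Z sb k K l q ka ta lo hi val) : ∀ i < k, val i < Z :=
  fun i h => by rw [← (hI.val_eq i h).2]; exact hI.lt _ (hI.val_eq i h).1

/-- The first pass, with `j` items to go. -/
theorem reaches_low {c7 c18 c19 : ℕ} (hZB : Z * Z ≤ B) (hZ : 1000 ≤ Z) (hMZ : M ≤ Z)
    (hI : IsItems g M Z sb k K l q ka ta lo hi val)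
    (H : ∀ f, LowInv g sb K lo hi val k f → ∀ c8 c9 c10 c11, Reaches B prog Q t (state M 135
      [c0, c1, c2, sb, v, c5, sb + 8 * k, c7, c8, c9, c10, c11, l + k, K, q, ka, ta, sb + 8 * k,
        c18, c19, 0] f inp out)) :
    ∀ j i f, i + j = k → LowInv g sb K lo hi val i f → ∀ c8 c9 c10 c11,
      Reaches B prog Q (t + 2 + 39 * j) (state M 95
        [c0, c1, c2, sb, v, c5, sb + 8 * k, c7, c8, c9, c10, c11, l + i, K, q, ka, ta, sb + 8 * i,
          c18, c19, 0] f inp out) := by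
  intro j
  induction j with
  | zero =>
    intro i f hij hf c8 c9 c10 c11
    obtain rfl : i = k := by omega
    refine Reaches.jlt (t := t + 1) rfl ?_
    simp only [List.getD_cons_succ, List.getD_cons_zero, lt_irrefl, if_false]
    exact Reaches.jump rfl (H f hf _ _ _ _)
  | succ j ih =>
    intro i f hij hf c8 c9 c10 c11
    have hik : i < k := by omega
    have hv := hI.val_eq i hik
    have hw := hI.word i hik
    have hM := hI.mem_le
    have hlo := hI.low_lt i hik
    refine Reaches.jlt (t := t + 2 + 39 * j + 38) rfl ?_
    simp only [List.getD_cons_succ, List.getD_cons_zero]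
    rw [if_pos (by omega)]
    have a1 := hf.frame _ hw.1
    have a2 := hf.frame _ hw.2
    refine reaches_digits (t := t + 2 + 39 * j + 25) (d := lo i) (e := hi i) hZB hZ hMZ (by omega) rfl
      (by omega) rfl (by omega) (by rw [a1]; exact hI.lt _ hw.1) (by rw [a2]; exact hI.lt _ hw.2)
      (by rw [a1, a2]; exact hI.low i hik) (by rw [a1, a2]; exact hI.high i hik) ?_
    refine reaches_push_low hZB hZ hMZ hlo (hI.high_lt i hik) hI.mem_le' (by omega) hv.1
      ((hf.frame _ hv.1).trans hv.2) (hI.val_lt i hik) ?_ fun c8 c10 c11 => ?_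
    · exact (hf.low _ hlo).lt (k := k) (fun j hj => ((mem_lowBucket.1 hj).1.trans hik)) (by omega)
    · rw [add_assoc l i 1]
      exact ih (i + 1) _ (by omega) hf.push _ _ _ _

theorem reaches_push_high {c6 c7 c9 c10 c11 c12 c17 c18 c19 i h x' old : ℕ} (hZB : Z * Z ≤ B)
    (hZ : 1000 ≤ Z) (hMZ : M ≤ Z) (hi : sb + 8 * i + 8 ≤ M) (hh : sb + 8 * h + 8 ≤ M)
    (h4 : f (sb + 8 * i + 4) = sb + 8 * h) (h2 : f (sb + 8 * i + 2) = x') (hx' : x' < M)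
    (h1 : f (sb + 8 * h + 1) = old) (hold : old < M)
    (H : ∀ c9 c10, Reaches B prog Q t (state M 136
      [c0, c1, c2, sb, v, c5, c6, c7, x', c9, c10, c11, c12, K, q, ka, ta, c17, c18, c19, 0]
      (Function.update (Function.update f (sb + 8 * h + 1) (sb + 8 * i)) (sb + 8 * i + 3) old)
        inp out)) :
    Reaches B prog Q (t + 14) (state M 143
      [c0, c1, c2, sb, v, c5, c6, c7, sb + 8 * i, c9, c10, c11, c12, K, q, ka, ta, c17, c18, c19, 0]
        f inp out) := by
  refine Reaches.block (t := t + 1) highCode 13 rfl rfl ?_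
  have hZB' : 1000 * Z ≤ B := (Nat.mul_le_mul_right Z hZ).trans hZB
  have u2 : ∀ x y, Function.update (Function.update f (sb + 8 * h + 1) x) (sb + 8 * i + 3) y
      (sb + 8 * i + 2) = x' := fun x y => by
    rw [Function.update_of_ne (by omega), Function.update_of_ne (by omega), h2]
  simp only [highCode, wp, BinOp.eval, List.set_cons_succ, List.set_cons_zero,
    List.getD_cons_succ, List.getD_cons_zero, List.length_cons, List.length_nil,
    Nat.reduceAdd, Nat.reduceLT, true_and, h4, h1, u2]
  refine ⟨?_, ?_, ?_, ?_, ?_, ?_, ?_, ?_, ?_, ?_, ?_, ?_, ?_, ?_, ?_, ?_,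
    Reaches.jump rfl (H _ _)⟩
  all_goals omega

/-- The second pass, when the items of `R` have been pushed to the buckets of their high digits,
the last one first; `x` points to the rest `L` of the current bucket, and the buckets of the low
digits below `b` remain. -/
structure HighInv (g : ℕ → ℕ) (sb k K : ℕ) (lo hi val : ℕ → ℕ) (b x : ℕ) (L R : List ℕ)
    (f : ℕ → ℕ) : Prop where
  frame : ∀ a < sb, f a = g a
  item : ∀ j < k, f (sb + 8 * j + 4) = sb + 8 * hi j ∧ f (sb + 8 * j + 5) = val j
  cur : Chain sb 2 f x L
  low : ∀ c < b, Chain sb 2 f (f (sb + 8 * c)) (lowBucket lo k c)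
  high : ∀ h < K, Chain sb 3 f (f (sb + 8 * h + 1)) (highBucket hi R h)
  total : (L ++ lowItems lo k b).reverse ++ R = (lowItems lo k K).reverse

theorem HighInv.mem {b x : ℕ} {L R : List ℕ} (h : HighInv g sb k K lo hi val b x L R f) :
    (∀ i ∈ L, i < k) ∧ (∀ i ∈ R, i < k) := by
  have key : ∀ i, i ∈ (L ++ lowItems lo k b).reverse ++ R → i < k := fun i hi => by
    rw [h.total, List.mem_reverse, mem_lowItems] at hi
    exact hi.1
  exact ⟨fun i hi => key i (by simp [hi]), fun i hi => key i (by simp [hi])⟩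

theorem HighInv.push {b x i : ℕ} {L R : List ℕ} (hik : i < k)
    (h : HighInv g sb k K lo hi val b x (i :: L) R f) :
    HighInv g sb k K lo hi val b (f (sb + 8 * i + 2)) L (i :: R)
      (Function.update (Function.update f (sb + 8 * hi i + 1) (sb + 8 * i)) (sb + 8 * i + 3)
        (f (sb + 8 * hi i + 1))) := by
  set f' := Function.update (Function.update f (sb + 8 * hi i + 1) (sb + 8 * i)) (sb + 8 * i + 3)
        (f (sb + 8 * hi i + 1)) with hf'
  have hne : ∀ a, a ≠ sb + 8 * hi i + 1 → a ≠ sb + 8 * i + 3 → f' a = f a := fun a h1 h2 => by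
    rw [hf', Function.update_of_ne h2, Function.update_of_ne h1]
  have e3 : f' (sb + 8 * i + 3) = f (sb + 8 * hi i + 1) := Function.update_self _ _ _
  have e1 : f' (sb + 8 * hi i + 1) = sb + 8 * i := by
    rw [hf', Function.update_of_ne (by omega), Function.update_self]
  have hnd : ((i :: L ++ lowItems lo k b).reverse ++ R).Nodup := by
    rw [h.total]; exact List.nodup_reverse.2 (nodup_lowItems K)
  have hiR : i ∉ R := fun hi =>
    List.disjoint_of_nodup_append hnd (by simp) hi
  have hch : ∀ d x, Chain sb 3 f x (highBucket hi R d) → Chain sb 3 f' x (highBucket hi R d) := by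
    intro d x hx
    refine hx.congr fun j hj => hne _ (by omega) ?_
    have : j ≠ i := by
      rintro rfl
      exact hiR (List.mem_filter.1 hj).1
    omega
  refine ⟨fun a ha => ?_, fun j hj => ?_, ?_, fun c hc => ?_, fun d hd => ?_, ?_⟩
  · rw [hne a (by omega) (by omega), h.frame a ha]
  · rw [hne _ (by omega) (by omega), hne _ (by omega) (by omega)]
    exact h.item j hj
  · exact h.cur.2.congr fun j _ => hne _ (by omega) (by omega)
  · rw [hne _ (by omega) (by omega)]
    exact (h.low c hc).congr fun j _ => hne _ (by omega) (by omega)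
  · rw [highBucket, List.filter_cons]
    by_cases hid : hi i = d
    · subst hid
      rw [if_pos (by simp), e1]
      refine ⟨rfl, ?_⟩
      rw [e3]
      exact hch _ _ (h.high _ hd)
    · rw [if_neg (by simpa using hid), hne _ (by omega) (by omega)]
      exact hch _ _ (h.high _ hd)
  · rw [← h.total]; simp

/-- The second pass; `n` counts the items and the buckets that remain. -/
theorem reaches_high {c6 c7 c12 c17 c19 : ℕ} (hZB : Z * Z ≤ B) (hZ : 1000 ≤ Z)
    (hMZ : M ≤ Z) (hsb : 0 < sb) (hI : IsItems g M Z sb k K l q ka ta lo hi val)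
    (H : ∀ f, HighInv g sb k K lo hi val 0 0 [] (lowItems lo k K).reverse f → ∀ c9 c10 c11,
      Reaches B prog Q t (state M 157
        [c0, c1, c2, sb, v, c5, c6, c7, 0, c9, c10, c11, c12, K, q, ka, ta, c17, sb, c19, 0]
          f inp out)) :
    ∀ n b x L R f, b ≤ K → L.length + (lowItems lo k b).length + b = n →
      HighInv g sb k K lo hi val b x L R f → ∀ c9 c10 c11,
      Reaches B prog Q (t + 3 + 15 * n) (state M 136
        [c0, c1, c2, sb, v, c5, c6, c7, x, c9, c10, c11, c12, K, q, ka, ta, c17, sb + 8 * b,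
          c19, 0] f inp out) := by
  have hZB' : 1000 * Z ≤ B := (Nat.mul_le_mul_right Z hZ).trans hZB
  have hM := hI.mem_le
  have hM' := hI.mem_le'
  intro n
  induction n with
  | zero =>
    intro b x L R f hbK hn hf c9 c10 c11
    obtain rfl : b = 0 := by omega
    obtain rfl : L = [] := List.eq_nil_of_length_eq_zero (by omega)
    obtain rfl : x = 0 := hf.cur
    have hR : R = (lowItems lo k K).reverse := by rw [← hf.total]; simp [lowItems]
    subst hR
    refine Reaches.jlt (t := t + 2) rfl ?_
    simp only [List.getD_cons_succ, List.getD_cons_zero, lt_irrefl, if_false]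
    refine Reaches.jlt (t := t + 1) rfl ?_
    simp only [List.getD_cons_succ, List.getD_cons_zero, Nat.mul_zero, Nat.add_zero, lt_irrefl,
      if_false]
    exact Reaches.jump rfl (H f hf _ _ _)
  | succ n ih =>
    intro b x L R f hbK hn hf c9 c10 c11
    cases L with
    | cons i L =>
      have hik : i < k := hf.mem.1 i (by simp)
      obtain rfl : x = sb + 8 * i := hf.cur.1
      have hpush := hf.push hik
      have hh := hI.high_lt i hik
      refine Reaches.jlt (t := t + 3 + 15 * n + 14) rfl ?_
      simp only [List.getD_cons_succ, List.getD_cons_zero]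
      rw [if_pos (by omega)]
      refine reaches_push_high hZB hZ hMZ (by omega) (by omega) (hf.item i hik).1 rfl ?_ rfl ?_ ?_
      · exact hf.cur.2.lt (k := k) (fun j hj => hf.mem.1 j (by simp [hj])) (by omega)
      · exact (hf.high _ hh).lt (k := k) (fun j hj => hf.mem.2 j (List.mem_filter.1 hj).1) (by omega)
      · intro c9 c10
        simp only [List.length_cons] at hn
        exact ih b _ L (i :: R) _ hbK (by omega) hpush _ _ _
    | nil =>
      obtain rfl : x = 0 := hf.cur
      refine Reaches.jlt (t := t + 3 + 15 * n + 14) rfl ?_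
      simp only [List.getD_cons_succ, List.getD_cons_zero, lt_irrefl, if_false]
      obtain ⟨b, rfl⟩ : ∃ b', b = b' + 1 := by
        refine Nat.exists_eq_succ_of_ne_zero ?_
        rintro rfl
        simp [lowItems] at hn
      refine Reaches.jlt (t := t + 3 + 15 * n + 13) rfl ?_
      simp only [List.getD_cons_succ, List.getD_cons_zero]
      rw [if_pos (by omega)]
      refine (Reaches.block (t := t + 3 + 15 * n + 1) prevBucketCode 3 rfl rfl ?_).mono (by omega)
      have e : sb + 8 * (b + 1) - 8 = sb + 8 * b := by omega
      simp only [prevBucketCode, wp, BinOp.eval, List.set_cons_succ, List.set_cons_zero,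
        List.getD_cons_succ, List.getD_cons_zero, List.length_cons, List.length_nil,
        Nat.reduceAdd, Nat.reduceLT, true_and, e]
      have hlt : f (sb + 8 * b) < M := (hf.low b (by omega)).lt (k := k)
        (fun j hj => (mem_lowBucket.1 hj).1) (by omega)
      refine ⟨by omega, by omega, by omega, by omega, Reaches.jump rfl ?_⟩
      refine ih b _ (lowBucket lo k b) R f (by omega) ?_ ?_ _ _ _
      · rw [lowItems_succ] at hn
        simp only [List.length_nil, List.length_append] at hn
        omega
      · refine ⟨hf.frame, hf.item, hf.low b (by omega), fun c hc => hf.low c (by omega), hf.high, ?_⟩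
        rw [← lowItems_succ]
        exact hf.total

/-- The output loop: `L` is the rest of the current bucket, and `j` buckets from `b` on remain;
`n` counts the items and the buckets together. -/
theorem reaches_output {c7 c12 c18 : ℕ} {R : List ℕ} (hZB : Z * Z ≤ B) (hZ : 1000 ≤ Z)
    (hMZ : M ≤ Z) (hsb : 0 < sb) (hI : IsItems g M Z sb k K l q ka ta lo hi val)
    (hitem : ∀ j < k, f (sb + 8 * j + 5) = val j) (hR : ∀ i ∈ R, i < k)
    (hhigh : ∀ h < K, Chain sb 3 f (f (sb + 8 * h + 1)) (highBucket hi R h))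
    {out' : List ℕ} (H : ∀ L inp, Q (state M 163 L f inp out')) :
    ∀ n j b x L out, (∀ i ∈ L, i < k) → b + j = K →
      L.length + ((List.range' b j).flatMap (highBucket hi R)).length + j = n →
      out ++ (L ++ (List.range' b j).flatMap (highBucket hi R)).map val = out' →
      Chain sb 3 f x L → ∀ c9 c10 c11,
      Reaches B prog Q (2 + 9 * n) (state M 161
        [c0, c1, c2, sb, v, c5, sb + 8 * K, c7, x, c9, c10, c11, c12, K, q, ka, ta, sb + 8 * b,
          c18, 8, 0] f inp out) := by
  have hZB' : 1000 * Z ≤ B := (Nat.mul_le_mul_right Z hZ).trans hZB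
  have hM := hI.mem_le
  have hM' := hI.mem_le'
  intro n
  induction n with
  | zero =>
    intro j b x L out hL hb hn hout hc c9 c10 c11
    obtain rfl : j = 0 := by omega
    obtain rfl : b = K := by omega
    obtain rfl : L = [] := List.eq_nil_of_length_eq_zero (by omega)
    obtain rfl : x = 0 := hc
    refine Reaches.jlt (t := 1) rfl ?_
    simp only [List.getD_cons_succ, List.getD_cons_zero, lt_irrefl, if_false]
    refine Reaches.jlt (t := 0) rfl ?_
    simp only [List.getD_cons_succ, List.getD_cons_zero, lt_irrefl, if_false]
    obtain rfl : out = out' := by simpa using hout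
    exact Reaches.refl (H _ _)
  | succ n ih =>
    intro j b x L out hL hb hn hout hc c9 c10 c11
    cases L with
    | cons i L =>
      have hik : i < k := hL i (by simp)
      obtain rfl : x = sb + 8 * i := hc.1
      have hvZ := hI.val_lt i hik
      have hx' : f (sb + 8 * i + 3) < M :=
        hc.2.lt (k := k) (fun j hj => hL j (by simp [hj])) (by omega)
      refine Reaches.jlt (t := 2 + 9 * n + 8) rfl ?_
      simp only [List.getD_cons_succ, List.getD_cons_zero]
      rw [if_pos (by omega)]
      refine Reaches.block (t := 2 + 9 * n + 5) [.const 9 5, .op .add 9 8 9, .load 9 9] 3 rfl rfl ?_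
      simp only [wp, BinOp.eval, List.set_cons_succ, List.set_cons_zero,
        List.getD_cons_succ, List.getD_cons_zero, List.length_cons, List.length_nil,
        Nat.reduceAdd, Nat.reduceLT, true_and, hitem i hik]
      refine ⟨by omega, by omega, by omega, by omega, Reaches.write (t := 2 + 9 * n + 4) rfl ?_⟩
      refine Reaches.block (t := 2 + 9 * n + 1) [.const 9 3, .op .add 8 8 9, .load 8 8] 3 rfl rfl ?_
      simp only [wp, BinOp.eval, List.set_cons_succ, List.set_cons_zero,
        List.getD_cons_succ, List.getD_cons_zero, List.length_cons, List.length_nil,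
        Nat.reduceAdd, Nat.reduceLT, true_and]
      refine ⟨by omega, by omega, by omega, by omega, Reaches.jump rfl ?_⟩
      simp only [List.length_cons] at hn
      exact ih j b _ L _ (fun j hj => hL j (by simp [hj])) hb (by omega)
        (by rw [← hout]; simp) hc.2 _ _ _
    | nil =>
      obtain rfl : x = 0 := hc
      refine Reaches.jlt (t := 2 + 9 * n + 8) rfl ?_
      simp only [List.getD_cons_succ, List.getD_cons_zero, lt_irrefl, if_false]
      obtain ⟨j, rfl⟩ : ∃ j', j = j' + 1 := by
        refine Nat.exists_eq_succ_of_ne_zero ?_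
        rintro rfl
        simp at hn
      refine Reaches.jlt (t := 2 + 9 * n + 7) rfl ?_
      simp only [List.getD_cons_succ, List.getD_cons_zero]
      rw [if_pos (by omega)]
      refine (Reaches.block (t := 2 + 9 * n + 1) nextBucketCode 4 rfl rfl ?_).mono (by omega)
      have e : sb + 8 * b + 8 = sb + 8 * (b + 1) := by ring
      have hmem : ∀ i ∈ highBucket hi R b, i < k := fun i hi => hR i (List.mem_filter.1 hi).1
      have hlt : f (sb + 8 * b + 1) < M := (hhigh b (by omega)).lt hmem (by omega)
      simp only [nextBucketCode, wp, BinOp.eval, List.set_cons_succ, List.set_cons_zero,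
        List.getD_cons_succ, List.getD_cons_zero, List.length_cons, List.length_nil,
        Nat.reduceAdd, Nat.reduceLT, true_and, e]
      refine ⟨by omega, by omega, by omega, by omega, by omega, Reaches.jump rfl ?_⟩
      refine ih j (b + 1) _ (highBucket hi R b) out hmem (by omega) ?_ ?_ (hhigh b (by omega)) _ _ _
      · simp only [List.range'_succ, List.flatMap_cons, List.length_append, List.length_nil] at hn
        omega
      · rw [← hout]; simp [List.range'_succ]

/-- Sorting and writing the `k` items of a node takes `O(k)` steps, since the radix `K` is at most
`2 * k`. -/
theorem reaches_report {c6 c7 c8 c9 c10 c11 : ℕ} (hZB : Z * Z ≤ B) (hZ : 1000 ≤ Z)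
    (hMZ : M ≤ Z) (hsb : 0 < sb) (hI : IsItems g M Z sb k K l q ka ta lo hi val) (hk : 1 ≤ k)
    (hK : K ≤ 2 * k)
    (hlt : ∀ i < k, ∀ j < k, val i < val j → hi i < hi j ∨ hi i = hi j ∧ lo i < lo j)
    (hinj : ∀ i < k, ∀ j < k, val i = val j → i = j)
    (hv : v + 20 ≤ sb) (h4 : g (v + 4) = l) (h5 : g (v + 5) = k) (h6 : g (v + 6) = K)
    (h7 : g (v + 7) = q) (h8 : g (v + 8) = ka) (h9 : g (v + 9) = ta)
    (hf : ∀ a < sb, f a = g a)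
    (H : ∀ f, (∀ a < sb, f a = g a) → ∀ L inp,
      Q (state M 163 L f inp (((Finset.range k).image val).sort (· ≤ ·)))) :
    Reaches B prog Q (200 * k) (state M 60
      [c0, c1, c2, sb, v, c5, c6, c7, c8, c9, c10, c11, 0, 0, 0, 0, 0, 0, 0, 0, 0] f inp []) := by
  have hZB' : 1000 * Z ≤ B := (Nat.mul_le_mul_right Z hZ).trans hZB
  have hM := hI.mem_le
  have hM' := hI.mem_le'
  have hgf : ∀ f : ℕ → ℕ, (∀ a < sb, f a = g a) → ∀ i < 20, ∀ y, g (v + i) = y → f (v + i) = y :=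
    fun f hf i hi y hy => (hf _ (by omega)).trans hy
  have hgZ : ∀ i < 20, ∀ y, g (v + i) = y → y < Z := fun i hi y hy => by
    rw [← hy]; exact hI.lt _ (by omega)
  have hlen : ((lowItems lo k K).length ≤ k) ∧
      ((List.range' 0 K).flatMap (highBucket hi (lowItems lo k K).reverse)).length ≤ k := by
    constructor
    · have := (List.subperm_of_subset (nodup_lowItems (lo := lo) (k := k) K)
        (l₂ := List.range k) fun i hi => List.mem_range.2 (mem_lowItems.1 hi).1).length_le
      simpa using this
    · rw [← List.range_eq_range', ← List.length_map (f := val),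
        map_highBucket_eq_sort hI.low_lt hI.high_lt hlt hinj, Finset.length_sort]
      exact Finset.card_image_le.trans (by simp)
  obtain ⟨hlen1, hlen2⟩ := hlen
  set n₂ := (lowItems lo k K).length with hn₂
  set n₃ := ((List.range' 0 K).flatMap (highBucket hi (lowItems lo k K).reverse)).length with hn₃
  have hbound : 2 + 9 * (n₃ + K) + 4 + 3 + 15 * (n₂ + K) + 1 + 2 + 39 * k + 7 + 2 + 8 * K + 19
      ≤ 200 * k := by omega
  refine Reaches.mono ?_ hbound
  refine reaches_record hZB hZ hMZ (by omega) (by omega) (hgf f hf 4 (by norm_num) _ h4)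
    (hgf f hf 6 (by norm_num) _ h6) (hgf f hf 7 (by norm_num) _ h7) (hgf f hf 8 (by norm_num) _ h8)
    (hgf f hf 9 (by norm_num) _ h9) (hgZ 4 (by norm_num) _ h4) (hgZ 7 (by norm_num) _ h7)
    (hgZ 8 (by norm_num) _ h8) (hgZ 9 (by norm_num) _ h9) ?_
  refine reaches_clear (g := g) hZB hZ hMZ hM' (fun f hf hclear c11 => ?_) K 0 f (by omega) hf
    (by simp) _
  refine reaches_count hZB hZ hMZ (by omega) (by omega) (hgf f hf 5 (by norm_num) _ h5)
    fun c8 => ?_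
  refine reaches_low hZB hZ hMZ hI (fun f hf c8 c9 c10 c11 => ?_) k 0 f (by omega)
    ⟨hf, fun b hb => (hclear b hb).2, fun b hb => (hclear b hb).1, by simp⟩ _ _ _ _
  refine Reaches.block [.const 8 0] 1 rfl rfl ?_
  simp only [wp, List.set_cons_succ, List.set_cons_zero, List.length_cons, List.length_nil,
    Nat.reduceAdd, Nat.reduceLT, true_and]
  refine ⟨by omega, ?_⟩
  refine reaches_high hZB hZ hMZ hsb hI (fun f hf c9 c10 c11 => ?_) (n₂ + K) K 0 [] [] f le_rfl
    (by simp [hn₂])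
    ⟨hf.frame, hf.item, rfl, hf.low, fun h hh => hf.high h hh, by simp⟩ _ _ _
  refine Reaches.block outputCode 4 rfl rfl ?_
  have e : K * 8 + sb = sb + 8 * K := by ring
  simp only [outputCode, wp, BinOp.eval, List.set_cons_succ, List.set_cons_zero,
    List.getD_cons_succ, List.getD_cons_zero, List.length_cons, List.length_nil,
    Nat.reduceAdd, Nat.reduceLT, true_and, e, Nat.add_zero]
  refine ⟨by omega, by omega, by omega, by omega, ?_⟩
  refine reaches_output (out' := ((Finset.range k).image val).sort (· ≤ ·)) hZB hZ hMZ hsb hI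
    (fun j hj => (hf.item j hj).2) hf.mem.2 hf.high (fun L inp => H f hf.frame L inp)
    (n₃ + K) K 0 0 [] [] (by simp) (by omega) (by simp [hn₃]) ?_ rfl _ _ _
  rw [← map_highBucket_eq_sort hI.low_lt hI.high_lt hlt hinj, List.range_eq_range']
  simp

end Report

end SortedReporting

/-! ### The data structure -/

namespace SortedReporting

/-- An array of elements of `s` that holds each `a ∈ s` at the index `f a`. -/
theorem exists_leftInverse {α : Type*} {s : Finset α} (hs : s.Nonempty) {f : α → ℕ}
    (hf : Set.InjOn f s) : ∃ g : ℕ → α, (∀ y, g y ∈ s) ∧ ∀ a ∈ s, g (f a) = a := by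
  classical
  obtain ⟨a₀, ha₀⟩ := hs
  have hex : ∀ y, ∃ a ∈ s, ∀ b ∈ s, f b = y → a = b := by
    intro y
    by_cases h : ∃ b ∈ s, f b = y
    · obtain ⟨b, hb, rfl⟩ := h
      exact ⟨b, hb, fun c hc h => hf hb hc h.symm⟩
    · exact ⟨a₀, ha₀, fun b hb hy => absurd ⟨b, hb, hy⟩ h⟩
  choose g hg1 hg2 using hex
  exact ⟨g, hg1, fun a ha => hg2 _ a ha rfl⟩

/-- The elements of `s` can be numbered by the naturals below its cardinality. -/
theorem exists_index {α : Type*} (s : Finset α) :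
    ∃ id : α → ℕ, (∀ a ∈ s, id a < s.card) ∧ Set.InjOn id s := by
  classical
  refine ⟨fun a => if h : a ∈ s then (s.equivFin ⟨a, h⟩ : ℕ) else 0, fun a ha => ?_, ?_⟩
  · simp only [dif_pos ha]; exact Fin.is_lt _
  · intro a ha b hb h
    simp only [dif_pos (Finset.mem_coe.1 ha), dif_pos (Finset.mem_coe.1 hb)] at h
    exact congrArg Subtype.val (s.equivFin.injective (Fin.ext h))

variable {σ : ℕ} {T : List (Fin σ)}

/-- The records `F 4, …, F 9` of the nodes, the suffix array `F 1`, and the packed key tables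
`F 16` and `F 17`. -/
def IsReport (T : List (Fin σ)) (S : ℕ) (F : ℕ → ℕ → ℕ) (id : Finset ℕ → ℕ) : Prop :=
  Set.InjOn (F 1) (Set.Iio (T.length + 1)) ∧ ∀ A ∈ nodes T, ∃ l K q wo po,
    F 4 (id A) = l ∧ F 5 (id A) = A.card ∧ F 6 (id A) = K ∧ F 7 (id A) = q ∧
    F 8 (id A) = 20 * wo + 16 ∧ F 9 (id A) = 20 * po + 17 ∧ 0 < K ∧ K ≤ 2 * A.card ∧
    l + A.card ≤ T.length + 1 ∧ A = (Finset.Ico l (l + A.card)).image (F 1) ∧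
    (∀ p < T.length + 1, wo + p / q < S ∧ po + p % q < S) ∧
    ∀ p ∈ Finset.Ico l (l + A.card), ∀ p' ∈ Finset.Ico l (l + A.card), F 1 p < F 1 p' →
      F 16 (wo + p / q) / F 17 (po + p % q) % (K * K) <
        F 16 (wo + p' / q) / F 17 (po + p' % q) % (K * K)

/-- The arrays exist, with `100 * T.length` entries each and small entries. -/
theorem exists_arrays (hT : T ≠ []) {Z : ℕ}
    (hZ : 10000 * ((T.length + σ) * (T.length + σ)) ≤ Z) :
    ∃ (F : ℕ → ℕ → ℕ) (id : Finset ℕ → ℕ), IsTree T (100 * T.length) Z F id ∧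
      IsReport T (100 * T.length) F id ∧ F 18 3 = 20 * id (Finset.range (T.length + 1)) ∧
      F 18 4 = 20 * (100 * T.length) := by
  classical
  set n := T.length with hn
  have hn1 : 1 ≤ n := List.length_pos_iff.2 hT
  have hσ1 : 1 ≤ σ := by
    obtain ⟨a, -, -⟩ := List.exists_cons_of_ne_nil hT
    exact Nat.one_le_of_lt a.2
  set b := n + σ with hb
  have hbb : b ≤ b * b := Nat.le_mul_of_pos_left _ (by omega)
  have hnσ : n * σ ≤ b * b := Nat.mul_le_mul (by omega) (by omega)
  have hnn : n * n ≤ b * b := Nat.mul_le_mul (by omega) (by omega)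
  -- nodes
  have hcard : (nodes T).card ≤ 4 * n := (card_nodes_le (T := T)).trans (by omega)
  obtain ⟨id, hid, hidinj⟩ := exists_index (nodes T)
  obtain ⟨node, hnode, hnodeid⟩ := exists_leftInverse ⟨_, range_mem_nodes (T := T)⟩ hidinj
  have hstart : ∀ A ∈ nodes T, start A + (label T A).length ≤ n := fun A hA => by
    have := length_add_le_of_mem_occurrences (T := T) (P := label T A) (i := start A)
      (by rw [occurrences_label hA]; exact start_mem hA)
    exact this
  -- the dictionary of the edges
  have hkeyinj : ∀ e : Finset ℕ × Fin σ, e.1 ∈ nodes T → ∀ e' : Finset ℕ × Fin σ, e'.1 ∈ nodes T →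
      id e.1 * σ + e.2 = id e'.1 * σ + e'.2 → e = e' := by
    intro e he e' he' h
    have h1 : id e.1 = id e'.1 := by
      have := congrArg (· / σ) h
      simpa [Nat.add_comm (_ * σ), Nat.add_mul_div_right _ _ hσ1,
        Nat.div_eq_of_lt e.2.2, Nat.div_eq_of_lt e'.2.2] using this
    rw [h1] at h
    exact Prod.ext (hidinj he he' h1) (Fin.ext (Nat.add_left_cancel h))
  have hkeylt : ∀ A ∈ nodes T, ∀ a : Fin σ, id A * σ + a < 4 * n * σ := by
    intro A hA a
    have h1 : id A + 1 ≤ 4 * n := (hid A hA).trans_le hcard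
    have h2 := Nat.mul_le_mul_right σ h1
    rw [Nat.add_mul] at h2
    have := a.2
    omega
  set X := (edges T).image fun e => id e.1 * σ + e.2 with hX
  have hXcard : X.card ≤ 4 * n := Finset.card_image_le.trans (card_edges_le.trans (by omega))
  have hXpos : 0 < X.card := ((edges_nonempty hT).image _).card_pos
  obtain ⟨p, hp, hpU, hpU'⟩ := Nat.exists_prime_lt_and_le_two_mul (4 * n * σ) (by positivity)
  have hXp : ∀ x ∈ X, x < p := by
    intro x hx
    obtain ⟨e, he, rfl⟩ := Finset.mem_image.1 hx
    exact (hkeylt _ (mem_edges.1 he).1 _).trans hpU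
  have hpZ : p < Z := by
    have : 2 * (4 * n * σ) = 8 * (n * σ) := by ring
    omega
  obtain ⟨k, k', sz, off, hk, hk', hsz, hoff, hslot⟩ := exists_perfectHash X hp hXp
  set slot : ℕ → ℕ := fun x => off (x * k % p % X.card) +
        x * k' (x * k % p % X.card) % p % sz (x * k % p % X.card) with hslotdef
  have hslotinj : Set.InjOn (fun e : Finset ℕ × Fin σ => slot (id e.1 * σ + e.2)) (edges T) := by
    intro e he e' he' h
    exact hkeyinj e (mem_edges.1 he).1 e' (mem_edges.1 he').1
      (hslot (Finset.mem_coe.2 (Finset.mem_image_of_mem _ he))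
        (Finset.mem_coe.2 (Finset.mem_image_of_mem _ he')) h)
  obtain ⟨cell, hcell, hcellslot⟩ := exists_leftInverse (edges_nonempty hT) hslotinj
  -- suffix array and keys
  obtain ⟨sa, hsa, hsainj, hsanode⟩ := exists_suffixArray T
  choose! lft hlft1 hlft2 using hsanode
  have hrank := fun j => (isLaminar_nodes (T := T)).exists_rank
    (Nat.mul_pos (radix_pos j) (radix_pos j))
  choose key hkey1 hkey2 using hrank
  obtain ⟨words, powers, q, woff, poff, hwords, hpowers, hlev⟩ :=
    exists_levels (N := n + 1) (by omega) (fun j p => key j (sa p)) fun j p => hkey1 j (sa p)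
  choose! lev hlev1 hlev2 hlev3 hlev4 using hlev
  have hNN : (2 * (n + 1)) ^ 2 ≤ 16 * (b * b) := by
    have : (2 * (n + 1)) ^ 2 ≤ (4 * n) ^ 2 := Nat.pow_le_pow_left (by omega) 2
    have : (4 * n) ^ 2 = 16 * (n * n) := by ring
    omega
  have hc : ∀ A ∈ nodes T, 1 ≤ A.card ∧ A.card ≤ n + 1 := fun A hA =>
    ⟨(mem_nodes.1 hA).1.card_pos,
      (Finset.card_le_card (subset_range_of_mem_nodes hA)).trans (by simp [hn])⟩
  let child : Finset ℕ × Fin σ → Finset ℕ := fun e => occurrences (label T e.1 ++ [e.2]) T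
  let F : ℕ → ℕ → ℕ := fun i x => match i with
    | 0 => (T.map Fin.val).getD x 0
    | 1 => sa x
    | 2 => 20 * (start (node x) + (label T (node x)).length)
    | 3 => id (node x) * σ
    | 4 => lft (node x)
    | 5 => (node x).card
    | 6 => radix (lev (node x).card)
    | 7 => q (lev (node x).card)
    | 8 => 20 * woff (lev (node x).card) + 16
    | 9 => 20 * poff (lev (node x).card) + 17
    | 10 => k' x
    | 11 => if x < X.card then sz x else 1
    | 12 => if x < X.card then 20 * off x else 0
    | 13 => id (cell x).1 * σ + (cell x).2
    | 14 => 20 * id (child (cell x))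
    | 15 => 20 * (start (child (cell x)) + ((label T (cell x).1).length + 1))
    | 16 => words x
    | 17 => powers x
    | 18 => match x with
      | 0 => k
      | 1 => p
      | 2 => X.card
      | 3 => 20 * id (Finset.range (n + 1))
      | 4 => 20 * (100 * n)
      | _ => 0
    | _ => 0
  have hlt : ∀ i x, F i x < Z := by
    intro i x
    have hx := hnode x
    have hcx := hc _ hx
    have hnb : n ≤ b := by omega
    have hσb : σ ≤ b := by omega
    have e0 : 4 * n * σ = 4 * (n * σ) := by ring
    match i with
    | 0 =>
      change (T.map Fin.val).getD x 0 < Z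
      rw [List.getD_eq_getElem?_getD, List.getElem?_map]
      cases h : T[x]? with
      | none => simp; omega
      | some a => have := a.2; simp; omega
    | 1 => have := hsa x; change sa x < Z; omega
    | 2 =>
      have := hstart _ hx
      change 20 * (start (node x) + (label T (node x)).length) < Z
      omega
    | 3 =>
      have := hkeylt _ hx ⟨0, hσ1⟩
      change id (node x) * σ < Z
      simp only [Nat.add_zero] at this
      omega
    | 4 => have := hlft1 _ hx; change lft (node x) < Z; omega
    | 5 => change (node x).card < Z; omega
    | 6 =>
      have := hlev2 _ hcx.1 hcx.2
      change radix (lev (node x).card) < Z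
      omega
    | 7 =>
      have := hlev3 _ hcx.1 hcx.2
      change q (lev (node x).card) < Z
      omega
    | 8 =>
      have := (Nat.le_add_right _ _).trans_lt (hlev4 _ hcx.1 hcx.2 0 (by omega)).1
      change 20 * woff (lev (node x).card) + 16 < Z
      omega
    | 9 =>
      have := (Nat.le_add_right _ _).trans_lt (hlev4 _ hcx.1 hcx.2 0 (by omega)).2.1
      change 20 * poff (lev (node x).card) + 17 < Z
      omega
    | 10 => exact (hk' x).trans hpZ
    | 11 =>
      change (if x < X.card then sz x else 1) < Z
      split_ifs with h
      · have := hoff x h; omega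
      · omega
    | 12 =>
      change (if x < X.card then 20 * off x else 0) < Z
      split_ifs with h
      · have := hoff x h; omega
      · omega
    | 13 =>
      have := hkeylt _ (mem_edges.1 (hcell x)).1 (cell x).2
      change id (cell x).1 * σ + (cell x).2 < Z
      omega
    | 14 =>
      have := hid _ (child_mem_nodes (hcell x))
      change 20 * id (child (cell x)) < Z
      simp only [child]
      omega
    | 15 =>
      have h1 := hstart _ (child_mem_nodes (hcell x))
      have h2 := hstart _ (mem_edges.1 (hcell x)).1
      change 20 * (start (child (cell x)) + ((label T (cell x).1).length + 1)) < Z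
      simp only [child]
      omega
    | 16 => have := hwords x; change words x < Z; omega
    | 17 => have := hpowers x; change powers x < Z; omega
    | 18 =>
      match x with
      | 0 => exact hk.trans hpZ
      | 1 => exact hpZ
      | 2 => change X.card < Z; omega
      | 3 =>
        have : id (Finset.range (n + 1)) < (nodes T).card := hid _ range_mem_nodes
        change 20 * id (Finset.range (n + 1)) < Z
        omega
      | 4 => change 20 * (100 * n) < Z; omega
      | _ + 5 => change 0 < Z; omega
    | _ + 19 => change 0 < Z; omega
  have hnid : ∀ A ∈ nodes T, node (id A) = A := hnodeid
  refine ⟨F, id, ⟨hlt, ?_, ?_, ?_, hp.pos, ?_, ?_, ?_⟩, ⟨hsainj, ?_⟩, rfl, rfl⟩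
  · intro A hA
    have := hid A hA
    omega
  · intro i a h
    have hi : i < n := (List.getElem?_eq_some_iff.1 h).1
    refine ⟨by omega, ?_⟩
    change (T.map Fin.val).getD i 0 = a
    simp [List.getD_eq_getElem?_getD, h]
  · intro A hA
    change 20 * (start (node (id A)) + (label T (node (id A))).length) = _
    rw [hnid A hA]
  · intro A hA a
    change id (node (id A)) * σ + a < Z
    rw [hnid A hA]
    have := hkeylt A hA a
    omega
  · intro x
    have : x * k % p % X.card < X.card := Nat.mod_lt _ hXpos
    change x * k % p % X.card < 100 * n
    omega
  · intro A hA a x h hx hh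
    have hFA : F 3 (id A) = id A * σ := by change id (node (id A)) * σ = _; rw [hnid A hA]
    rw [hFA] at hx
    have hh : h = x * k % p % X.card := hh
    have hhX : h < X.card := by rw [hh]; exact Nat.mod_lt _ hXpos
    have hsl : slot x = off h + x * k' h % p % sz h := by rw [hslotdef, hh]
    have hm : x * k' h % p % sz h < sz h := Nat.mod_lt _ (hsz h)
    have ho := hoff h hhX
    refine ⟨slot x, by omega, ?_, ?_, ?_⟩
    · change x * k' h % p % (if h < X.card then sz h else 1) * 20 +
        (if h < X.card then 20 * off h else 0) = 20 * slot x
      rw [if_pos hhX, if_pos hhX, hsl]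
      ring
    · intro hne
      have he : (A, a) ∈ edges T := mem_edges.2 ⟨hA, hne⟩
      have hcs : cell (slot x) = (A, a) := by rw [hx]; exact hcellslot (A, a) he
      refine ⟨?_, ?_, ?_⟩
      · change id (cell (slot x)).1 * σ + (cell (slot x)).2 = x
        rw [hcs, hx]
      · change 20 * id (child (cell (slot x))) = _
        rw [hcs]
      · change 20 * (start (child (cell (slot x))) + ((label T (cell (slot x)).1).length + 1)) = _
        rw [hcs]
    · intro hne hkey
      change id (cell (slot x)).1 * σ + (cell (slot x)).2 = x at hkey
      have he := mem_edges.1 (hcell (slot x))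
      rw [hx] at hkey he
      have := hkeyinj _ he.1 (A, a) hA hkey
      rw [this] at he
      exact hne he.2
  · intro A hA
    have hcA := hc A hA
    set j := lev A.card with hj
    refine ⟨lft A, radix j, q j, woff j, poff j, ?_, ?_, ?_, ?_, ?_, ?_, radix_pos j,
      hlev2 _ hcA.1 hcA.2, hlft1 A hA, hlft2 A hA, ?_, ?_⟩
    · change lft (node (id A)) = _; rw [hnid A hA]
    · change (node (id A)).card = _; rw [hnid A hA]
    · change radix (lev (node (id A)).card) = _; rw [hnid A hA]
    · change q (lev (node (id A)).card) = _; rw [hnid A hA]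
    · change 20 * woff (lev (node (id A)).card) + 16 = _; rw [hnid A hA]
    · change 20 * poff (lev (node (id A)).card) + 17 = _; rw [hnid A hA]
    · intro p hp
      have := hlev4 _ hcA.1 hcA.2 p hp
      rw [← hj] at this
      exact ⟨by omega, by omega⟩
    · intro p hp p' hp' hlt
      have hl := hlft1 A hA
      have m1 := Finset.mem_Ico.1 hp
      have m2 := Finset.mem_Ico.1 hp'
      have h1 := (hlev4 _ hcA.1 hcA.2 p (by omega)).2.2
      have h2 := (hlev4 _ hcA.1 hcA.2 p' (by omega)).2.2
      change words _ / powers _ % _ < words _ / powers _ % _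
      rw [h1, h2]
      refine hkey2 j A hA (hlev1 _ hcA.1 hcA.2) _ ?_ _ ?_ hlt
      · rw [hlft2 A hA]; exact Finset.mem_image_of_mem _ hp
      · rw [hlft2 A hA]; exact Finset.mem_image_of_mem _ hp'

end SortedReporting

/-! ### Correctness of the query program -/

namespace SortedReporting

variable {σ : ℕ} {T : List (Fin σ)} {B M Z S : ℕ} {F : ℕ → ℕ → ℕ} {id : Finset ℕ → ℕ}

/-- The memory image of twenty interleaved arrays. -/
def interleave (F : ℕ → ℕ → ℕ) (a : ℕ) : ℕ := F (a % 20) (a / 20)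

theorem interleave_apply (F : ℕ → ℕ → ℕ) {i x : ℕ} (hi : i < 20) : interleave F (20 * x + i) = F i x := by
  rw [interleave, show (20 * x + i) % 20 = i by omega, show (20 * x + i) / 20 = x by omega]

/-- The report of the node `A` writes its positions in increasing order. -/
theorem reaches_node {Q : Config → Prop} {f : ℕ → ℕ} {inp : List ℕ} (hT : IsTree T S Z F id)
    (hR : IsReport T S F id) (hZB : Z * Z ≤ B) (hZ : 1000 ≤ Z) (hMZ : M ≤ Z)
    (hSM : 20 * S + 16 * T.length + 24 ≤ M) (hnS : T.length + 1 ≤ S)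
    (hf : ∀ a < 20 * S, f a = interleave F a) {A : Finset ℕ} (hA : A ∈ nodes T)
    (H : ∀ f, (∀ a < 20 * S, f a = interleave F a) → ∀ L inp,
      Q (state M 163 L f inp (A.sort (· ≤ ·)))) (c0 c1 c2 c5 c6 c7 c8 c9 c10 c11 : ℕ) :
    Reaches B prog Q (200 * A.card) (state M 60
      [c0, c1, c2, 20 * S, 20 * id A, c5, c6, c7, c8, c9, c10, c11, 0, 0, 0, 0, 0, 0, 0, 0, 0]
        f inp []) := by
  obtain ⟨hinj, hnode⟩ := hR
  obtain ⟨l, K, q, wo, po, h4, h5, h6, h7, h8, h9, hK0, hK, hl, hAl, haddr, hkey⟩ := hnode A hA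
  have hid := hT.id_lt A hA
  have hc : 1 ≤ A.card := (mem_nodes.1 hA).1.card_pos
  have hw : ∀ p, p / q * 20 + (20 * wo + 16) = 20 * (wo + p / q) + 16 := fun p => by ring
  have hp : ∀ p, p % q * 20 + (20 * po + 17) = 20 * (po + p % q) + 17 := fun p => by ring
  set lo : ℕ → ℕ := fun i => interleave F ((l + i) / q * 20 + (20 * wo + 16)) /
    interleave F ((l + i) % q * 20 + (20 * po + 17)) % K with hlo
  set hi : ℕ → ℕ := fun i => interleave F ((l + i) / q * 20 + (20 * wo + 16)) /
    interleave F ((l + i) % q * 20 + (20 * po + 17)) / K % K with hhi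
  set val : ℕ → ℕ := fun i => F 1 (l + i) with hval
  have hI : IsItems (interleave F) M Z (20 * S) A.card K l q (20 * wo + 16) (20 * po + 17) lo hi val := by
    refine ⟨fun i hi => ⟨by omega, ?_⟩, fun i hi => ?_, fun i _ => rfl, fun i _ => rfl,
      fun a _ => hT.lt _ _, hK0, by omega, by omega⟩
    · rw [mul_comm]; exact interleave_apply F (by norm_num)
    · have := haddr (l + i) (by omega)
      rw [hw, hp]
      omega
  -- the two digits determine the key
  have hdig : ∀ i, F 16 (wo + (l + i) / q) / F 17 (po + (l + i) % q) % (K * K) =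
      lo i + K * hi i := by
    intro i
    simp only [hlo, hhi, hw, hp, interleave_apply F (show 16 < 20 by norm_num),
      interleave_apply F (show 17 < 20 by norm_num)]
    exact Nat.mod_mul
  have hlt : ∀ i < A.card, ∀ j < A.card, val i < val j → hi i < hi j ∨ hi i = hi j ∧ lo i < lo j := by
    intro i hiA j hjA hij
    have h := hkey (l + i) (by simp; omega) (l + j) (by simp; omega) hij
    rw [hdig, hdig] at h
    have h1 := hI.low_lt j hjA
    rcases lt_trichotomy (hi i) (hi j) with h2 | h2 | h2
    · exact Or.inl h2
    · rw [h2] at h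
      exact Or.inr ⟨h2, by omega⟩
    · have := Nat.mul_le_mul_left K (Nat.succ_le_of_lt h2)
      rw [Nat.mul_succ] at this
      omega
  have hvinj : ∀ i < A.card, ∀ j < A.card, val i = val j → i = j := by
    intro i hiA j hjA hij
    have := hinj (Set.mem_Iio.2 (by omega)) (Set.mem_Iio.2 (by omega)) hij
    omega
  have himg : (Finset.range A.card).image val = A := by
    conv_rhs => rw [hAl]
    ext x
    simp only [hval, Finset.mem_image, Finset.mem_range, Finset.mem_Ico]
    constructor
    · rintro ⟨i, hi, rfl⟩
      exact ⟨l + i, by omega, rfl⟩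
    · rintro ⟨p, hp, rfl⟩
      exact ⟨p - l, by omega, by rw [Nat.add_sub_cancel' hp.1]⟩
  refine reaches_report (g := interleave F) hZB hZ hMZ (by omega) hI hc hK hlt hvinj (by omega)
    ((interleave_apply F (by norm_num)).trans h4) ((interleave_apply F (by norm_num)).trans h5)
    ((interleave_apply F (by norm_num)).trans h6) ((interleave_apply F (by norm_num)).trans h7)
    ((interleave_apply F (by norm_num)).trans h8) ((interleave_apply F (by norm_num)).trans h9) hf ?_
  rw [himg]
  exact H

/-- The query program halts in time, with the list of occurrences and an intact data structure. -/
theorem reaches_query {Q : Config → Prop} {f : ℕ → ℕ} (hT : IsTree T S Z F id)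
    (hR : IsReport T S F id) (hZB : Z * Z ≤ B) (hZ : 1000 ≤ Z) (hMZ : M ≤ Z)
    (hSM : 20 * S + 16 * T.length + 24 ≤ M) (hnS : T.length + 5 ≤ S) (hσ : σ ≤ Z)
    (hroot : F 18 3 = 20 * id (Finset.range (T.length + 1))) (hscratch : F 18 4 = 20 * S)
    (hf : ∀ a < 20 * S, f a = interleave F a) (P : List (Fin σ))
    (H : ∀ f, (∀ a < 20 * S, f a = interleave F a) → ∀ L inp,
      Q (state M 163 L f inp ((occurrences P T).sort (· ≤ ·)))) :
    Reaches B prog Q (200 * (occurrences P T).card + 1 + 50 * P.length + 13)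
      (state M 0 (List.replicate 21 0) f (P.map Fin.val) []) := by
  have hA : Finset.range (T.length + 1) ∈ nodes T := range_mem_nodes
  have hid := hT.id_lt _ hA
  have hfF : ∀ x < S, ∀ i < 20, f (20 * x + i) = F i x := fun x hx i hi =>
    (hf _ (by omega)).trans (interleave_apply F hi)
  have hZB' : 1000 * Z ≤ B := (Nat.mul_le_mul_right Z hZ).trans hZB
  have f0 : f 18 = F 18 0 := hfF 0 (by omega) 18 (by norm_num)
  have f1 : f 38 = F 18 1 := hfF 1 (by omega) 18 (by norm_num)
  have f2 : f 58 = F 18 2 := hfF 2 (by omega) 18 (by norm_num)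
  have f3 : f 78 = 20 * id (Finset.range (T.length + 1)) :=
    (hfF 3 (by omega) 18 (by norm_num)).trans hroot
  have f4 : f 98 = 20 * S := (hfF 4 (by omega) 18 (by norm_num)).trans hscratch
  have fe := (hfF _ hid 2 (by norm_num)).trans (hT.last _ hA)
  have b0 := hT.lt 18 0
  have b1 := hT.lt 18 1
  have b2 := hT.lt 18 2
  have be := hT.lt 2 (id (Finset.range (T.length + 1)))
  rw [hT.last _ hA] at be
  have hstart : start (Finset.range (T.length + 1)) = 0 :=
    Nat.sInf_eq_zero.2 (Or.inl (by simp))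
  refine Reaches.block initCode 13 rfl rfl ?_
  simp only [initCode, wp, BinOp.eval, List.replicate_succ, List.replicate_zero,
    List.set_cons_succ, List.set_cons_zero,
    List.getD_cons_succ, List.getD_cons_zero, List.length_cons, List.length_nil,
    Nat.reduceAdd, Nat.reduceLT, true_and, f0, f1, f2, f3, f4, fe]
  refine ⟨by omega, by omega, by omega, by omega, by omega, by omega, by omega, by omega, by omega,
    by omega, by omega, by omega, by omega, by omega, by omega, by omega, by omega, by omega,
    by omega, ?_⟩
  have := reaches_match (Q := Q) (B := B) (out := []) (t := 200 * (occurrences P T).card) hT hZB hZ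
    hMZ (by omega) hσ hfF (20 * S) P [] _ hA occurrences_nil
    (fun h L inp => ?_) (fun A hA hPA tp e r7 r8 r9 r10 r11 => ?_) 0 0 0 0 0
  · rw [hstart] at this ⊢
    exact this
  · have := H f hf L inp
    rw [List.nil_append] at h
    rw [h] at this
    simpa using this
  · rw [List.nil_append] at hPA
    subst hPA
    exact reaches_node hT hR hZB hZ hMZ hSM (by omega) hf hA H _ _ _ _ _ _ _ _ _ _

end SortedReporting

open SortedReporting in
theorem mainTheorem3 :
    ∃ (prog : List WordRAM.Instr) (c : ℕ),
      ∀ (σ : ℕ) (T : List (Fin σ)), T ≠ [] →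
        ∃ D : List ℕ, D.length ≤ c * T.length ∧ (∀ x ∈ D, x < (T.length + σ) ^ c) ∧
          ∀ (P : List (Fin σ)) (W : List ℕ),
            W.length = c * T.length → (∀ x ∈ W, x < (T.length + σ) ^ c) →
              ∃ t ≤ c * (P.length + (occurrences P T).card), ∃ W' : List ℕ,
                WordRAM.HaltsIn ((T.length + σ) ^ c) prog (D ++ W) (P.map Fin.val) t (D ++ W')
                  ((occurrences P T).sort (· ≤ ·)) := by
  refine ⟨prog, 2000, fun σ T hT => ?_⟩
  have hn1 : 1 ≤ T.length := List.length_pos_iff.2 hT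
  have hσ1 : 1 ≤ σ := by
    obtain ⟨a, -, -⟩ := List.exists_cons_of_ne_nil hT
    exact Nat.one_le_of_lt a.2
  -- all entries and addresses are below `Z`, the square root of the word bound
  set b := T.length + σ with hb
  have hb0 : 0 < b := by omega
  obtain ⟨Z, hZ⟩ : ∃ Z, Z = b ^ 1000 := ⟨_, rfl⟩
  have hZB : b ^ 2000 = Z * Z := by rw [hZ, ← pow_add]
  have hbb : b ≤ b * b := Nat.le_mul_of_pos_left _ (by omega)
  have hZlow : 10000 * (b * b) ≤ Z := by
    calc 10000 * (b * b) ≤ 2 ^ 14 * (b * b) := Nat.mul_le_mul_right _ (by norm_num)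
      _ ≤ b ^ 14 * (b * b) := Nat.mul_le_mul_right _ (Nat.pow_le_pow_left (by omega) _)
      _ = b ^ 16 := by ring
      _ ≤ Z := (Nat.pow_le_pow_right hb0 (by norm_num)).trans_eq hZ.symm
  rw [hZB]
  obtain ⟨F, id, hTree, hReport, hroot, hscratch⟩ := exists_arrays hT hZlow
  set S := 100 * T.length with hS
  refine ⟨(List.range (20 * S)).map (interleave F), by simp; omega, fun x hx => ?_, fun P W hW _ => ?_⟩
  · obtain ⟨a, -, rfl⟩ := List.mem_map.1 hx
    exact (hTree.lt _ _).trans_le (Nat.le_mul_of_pos_left _ (by omega))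
  · set M := 20 * S + W.length with hM
    set f : ℕ → ℕ := fun a => if a < 20 * S then interleave F a else W.getD (a - 20 * S) 0 with hf
    have hmem : (List.range (20 * S)).map (interleave F) ++ W = (List.range M).map f := by
      rw [hM, List.range_add, List.map_append]
      congr 1
      · refine List.map_congr_left fun a ha => ?_
        rw [hf]
        exact (if_pos (List.mem_range.1 ha)).symm
      · refine List.ext_getElem (by simp) fun i h1 h2 => ?_
        simp [hf, List.getElem?_eq_getElem h1]
    have hreach := reaches_query (Q := fun c => prog[c.pc]? = some Instr.halt ∧
        (∃ W', c.mem = (List.range (20 * S)).map (interleave F) ++ W') ∧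
        c.output = (occurrences P T).sort (· ≤ ·)) (B := Z * Z) (M := M) (f := f)
      hTree hReport le_rfl (by omega) (by omega) (by omega) (by omega) (by omega) hroot hscratch
      (fun a ha => if_pos ha) P fun f' hf' L inp => by
        refine ⟨rfl, ⟨(List.range W.length).map fun i => f' (20 * S + i), ?_⟩, rfl⟩
        change (List.range M).map f' = _
        rw [hM, List.range_add, List.map_append, List.map_map]
        congr 1
        exact List.map_congr_left fun a ha => hf' a (List.mem_range.1 ha)
    obtain ⟨t, ht, c, hrun, hhalt, ⟨W', hW'⟩, hout⟩ := hreach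
    -- the empty pattern occurs, so the constant part of the running time is paid for
    have hpos : 1 ≤ P.length + (occurrences P T).card := by
      cases P with
      | nil => rw [occurrences_nil]; simp
      | cons a P => simp only [List.length_cons]; omega
    refine ⟨t, ht.trans (by omega), W', c, ?_, hhalt, hW', hout⟩
    rw [← hrun, hmem]
    congr 1
    simp only [init, state]
    congr 1
    funext r
    rcases lt_or_ge r 21 with h | h
    · rw [List.getD_replicate _ h]
    · rw [List.getD_eq_default _ _ (by simpa using h)]
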